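/- Let $N\ge 1$ and let $k,m,n$ be integers with $$k>\tfrac N2,\qquad n>\max\Big\{\tfrac N2+1,\tfrac N2\Big\},\qquad 2m\ge k+n+3,$$ and set $J=2m+2+k$, $\langle x\rangle=(1+|x|^2)^{1/2}$. Let $\mathcal X=\mathcal X_2$ be the space of all $u\in H^J(\mathbb R^N,\mathbb C^2)$ such that $\langle x\rangle^nD^\beta u\in L^\infty(\mathbb R^N,\mathbb C^2)$ for $0\le|\beta|\le 2m-2$ and $\langle x\rangle^nD^\beta u\in L^2(\mathbb R^N,\mathbb C^2)$ for $2m-1\le|\beta|\le J$, equipped with the norm $$\|u\|_{\mathcal X}=\sum_{|\beta|=0}^{2m-2}\|\langle x\rangle^nD^\beta u\|_{L^\infty}+\sum_{|\beta|=2m-1}^{J}\|\langle x\rangle^nD^\beta u\|_{L^2}.$$ Let $\gamma=\begin{pmatrix}1&0\\0&-1\end{pmatrix}$, let $\langle i\nabla\rangle=(I-\Delta)^{1/2}=\mathcal F^{-1}\langle\xi\rangle\mathcal F$ (with $\mathcal F u(\xi)=\int e^{-ix\cdot\xi}u(x)\,dx$), and let $(e^{-it\gamma\langle i\nabla\rangle})_{t\in\mathbb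 R}$ be the corresponding group of isometries of $L^2(\mathbb R^N,\mathbb C^2)$, i.e. the Fourier multiplier with matrix symbol $e^{-it\langle\xi\rangle\gamma}$. Then $t\mapsto e^{-it\gamma\langle i\nabla\rangle}\psi$ belongs to $C(\mathbb R,\mathcal X)$ for every $\psi\in\mathcal X$, and the linear map $\psi\mapsto e^{-it\gamma\langle i\nabla\rangle}\psi$ is continuous from $\mathcal X$ into $C(\mathbb R,\mathcal X)$ (with uniform convergence on bounded intervals): for every $T$ there is $C_T>0$ such that $\|e^{-it\gamma\langle i\nabla\rangle}\psi\|_{\mathcal X}\le C_T\|\psi\|_{\mathcal X}$ for all $|t|\le T$ and all $\psi\in\mathcal X$. Moreover, there exist $C>0$ and $t_0>0$ such that $$\|e^{-it\gamma\langle i\nabla\rangle}\psi\|_{\mathcal X}\le C(1+|t|)^{2m+n+1}\|\psi\|_{\mathcal X}$$ and $$\sup_{|\beta|\le 2m}\|\langle x\rangle^nD^\beta(e^{-it\gamma\langle i\nabla\rangle}\psi-\psi)\|_{L^\infty}\le C|t|(1+|t|)^{2m+n+1}\|\psi\|_{\mathcal X}$$ for all $|t|\le t_0$ and all $\psi\in\mathcal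 X$. -/

import Mathlib

open MeasureTheory FourierTransform LineDeriv Filter Topology
open scoped ENNReal SchwartzMap

noncomputable section

namespace HalfWave

/-- `ℝ^N` with its Euclidean norm. -/
abbrev Rn (N : ℕ) := EuclideanSpace ℝ (Fin N)

/-- `ℂ^d` with its Hermitian norm. -/
abbrev Cd (d : ℕ) := EuclideanSpace ℂ (Fin d)

/-- The Lebesgue space `L²(ℝ^N, ℂ^d)`. -/
abbrev L2 (N d : ℕ) := Lp (Cd d) 2 (volume : Measure (Rn N))

/-- The Japanese bracket `⟨x⟩ = (1 + |x|²)^{1/2}`. -/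
def bracket {N : ℕ} (x : Rn N) : ℝ := (1 + ‖x‖ ^ 2) ^ (1 / 2 : ℝ)

/-! ### Derivatives and weighted norms -/

/-- The distributional derivative `D^β = ∂_1^{β_1} ⋯ ∂_N^{β_N}` of a tempered distribution,
for a multi-index `β`. -/
def multiDeriv {N d : ℕ} (β : Fin N → ℕ) (u : 𝓢'(Rn N, Cd d)) : 𝓢'(Rn N, Cd d) :=
  (List.finRange N).foldr
    (fun i w => (fun z : 𝓢'(Rn N, Cd d) => ∂_{EuclideanSpace.single i (1 : ℝ)} z)^[β i] w) u

/-- The `L^p` norm of a tempered distribution: it is `‖g‖_{L^p}` if the distribution is given by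
a (necessarily unique) function `g ∈ L^p`, and `∞` if it is not given by such a function. -/
def distLpNorm {N d : ℕ} (p : ℝ≥0∞) [Fact (1 ≤ p)] (T : 𝓢'(Rn N, Cd d)) : ℝ≥0∞ :=
  ⨅ (g : Lp (Cd d) p (volume : Measure (Rn N))) (_ : T = (g : 𝓢'(Rn N, Cd d))), ‖g‖ₑ

/-- `‖⟨x⟩^n D^β u‖_{L^p} ∈ [0, ∞]`. -/
def weightedNorm {N d : ℕ} (n : ℕ) (p : ℝ≥0∞) [Fact (1 ≤ p)] (β : Fin N → ℕ) (u : L2 N d) :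
    ℝ≥0∞ :=
  distLpNorm p (TemperedDistribution.smulLeftCLM (Cd d)
    (fun x : Rn N => ((bracket x ^ n : ℝ) : ℂ)) (multiDeriv β (u : 𝓢'(Rn N, Cd d))))

/-- The multi-indices `β ∈ ℕ^N` of length `|β| = j`. -/
def multiIndices (N j : ℕ) : Finset (Fin N → ℕ) := Finset.piAntidiag Finset.univ j

/-! ### The space `𝒳_d` -/

/-- The order `J = 2m + 2 + k`. -/
def order (k m : ℕ) : ℕ := 2 * m + 2 + k

/-- The norm `‖u‖_{𝒳_d}`, with values in `[0, ∞]`. -/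
def spaceNorm {N d : ℕ} (k m n : ℕ) (u : L2 N d) : ℝ≥0∞ :=
  (∑ j ∈ Finset.Icc 0 (2 * m - 2), ∑ β ∈ multiIndices N j, weightedNorm n ∞ β u)
    + ∑ j ∈ Finset.Icc (2 * m - 1) (order k m), ∑ β ∈ multiIndices N j, weightedNorm n 2 β u

/-- The space `𝒳_d`: all `u ∈ H^J(ℝ^N, ℂ^d)` with `⟨x⟩^n D^β u ∈ L^∞` for `0 ≤ |β| ≤ 2m - 2`
and `⟨x⟩^n D^β u ∈ L²` for `2m - 1 ≤ |β| ≤ J`. -/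
def space (N d k m n : ℕ) : Set (L2 N d) :=
  {u | TemperedDistribution.MemSobolev (order k m : ℝ) 2 (u : 𝓢'(Rn N, Cd d)) ∧
    (∀ β : Fin N → ℕ, ∑ i, β i ≤ 2 * m - 2 → weightedNorm n ∞ β u < ∞) ∧
    (∀ β : Fin N → ℕ, 2 * m - 1 ≤ ∑ i, β i → ∑ i, β i ≤ order k m →
      weightedNorm n 2 β u < ∞)}

/-- `v ∈ C(ℝ, 𝒳_d)`. -/
def ContinuousInSpace {N d : ℕ} (k m n : ℕ) (v : ℝ → L2 N d) : Prop :=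
  (∀ t, v t ∈ space N d k m n) ∧
    ∀ s, Tendsto (fun t => spaceNorm k m n (v t - v s)) (𝓝 s) (𝓝 0)

/-! ### The group `e^{-itγ⟨i∇⟩}` -/

/-- The Pauli matrix `γ`. -/
def gamma : Matrix (Fin 2) (Fin 2) ℂ := !![1, 0; 0, -1]

/-- The symbol `exp(-i t ⟨2πξ⟩ γ)` of `e^{-itγ⟨i∇⟩}`. The factor `2π` comes from the normalization
`𝓕 f(ξ) = ∫ e^{-2πi x·ξ} f(x) dx`, for which `⟨i∇⟩ = (1 - Δ)^{1/2}` is `𝓕⁻ ⟨2πξ⟩ 𝓕`. -/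
def symbol {N : ℕ} (t : ℝ) (ξ : Rn N) : Matrix (Fin 2) (Fin 2) ℂ :=
  NormedSpace.exp ((-(Complex.I * t * bracket ((2 * Real.pi) • ξ))) • gamma)

/-- The action of the symbol on a vector of `ℂ²`. -/
def symbolAct {N : ℕ} (t : ℝ) (ξ : Rn N) (z : Cd 2) : Cd 2 :=
  WithLp.toLp 2 ((symbol t ξ).mulVec z)

theorem symbol_eq {N : ℕ} (t : ℝ) (ξ : Rn N) :
    symbol t ξ = Matrix.diagonal
      ![Complex.exp (-(Complex.I * t * bracket ((2 * Real.pi) • ξ))),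
        Complex.exp (Complex.I * t * bracket ((2 * Real.pi) • ξ))] := by
  have h : (-(Complex.I * t * bracket ((2 * Real.pi) • ξ))) • gamma = Matrix.diagonal
      ![-(Complex.I * t * bracket ((2 * Real.pi) • ξ)),
        Complex.I * t * bracket ((2 * Real.pi) • ξ)] := by
    ext i j
    fin_cases i <;> fin_cases j <;> simp [gamma]
  rw [symbol, h, Matrix.exp_diagonal]
  congr 1
  ext i
  rw [Pi.coe_exp]
  fin_cases i <;> simp [Complex.exp_eq_exp_ℂ]

theorem norm_symbolAct {N : ℕ} (t : ℝ) (ξ : Rn N) (z : Cd 2) : ‖symbolAct t ξ z‖ = ‖z‖ := by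
  have h1 : ∀ a b : ℝ, ‖Complex.exp (-(Complex.I * a * b))‖ = 1 := fun a b => by
    rw [Complex.norm_exp]; simp
  have h2 : ∀ a b : ℝ, ‖Complex.exp (Complex.I * a * b)‖ = 1 := fun a b => by
    rw [Complex.norm_exp]; simp
  simp [symbolAct, symbol_eq, EuclideanSpace.norm_eq, h1, h2]

theorem continuous_bracket {N : ℕ} : Continuous (bracket : Rn N → ℝ) := by
  unfold bracket
  exact (by fun_prop : Continuous fun x : Rn N => 1 + ‖x‖ ^ 2).rpow_const
    fun x => Or.inl (by positivity)

theorem continuous_symbolAct {N : ℕ} (t : ℝ) :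
    Continuous fun q : Rn N × Cd 2 => symbolAct t q.1 q.2 := by
  have hb := continuous_bracket (N := N)
  unfold symbolAct
  refine (PiLp.continuous_toLp 2 _).comp (continuous_pi fun i => ?_)
  simp only [symbol_eq, Matrix.mulVec_diagonal]
  fin_cases i <;> simp <;> fun_prop

theorem memLp_symbolAct {N : ℕ} (t : ℝ) (f : L2 N 2) :
    MemLp (fun ξ => symbolAct t ξ (f ξ)) 2 (volume : Measure (Rn N)) := by
  have hm : AEStronglyMeasurable (fun ξ => symbolAct t ξ (f ξ)) (volume : Measure (Rn N)) := by
    have hp : AEStronglyMeasurable (fun ξ => (ξ, f ξ)) (volume : Measure (Rn N)) :=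
      continuous_id.aestronglyMeasurable.prodMk (Lp.aestronglyMeasurable f)
    exact Continuous.comp_aestronglyMeasurable
      (g := fun q : Rn N × Cd 2 => symbolAct t q.1 q.2) (f := fun ξ : Rn N => (ξ, f ξ))
      (continuous_symbolAct t) hp
  exact (Lp.memLp f).congr_norm hm (ae_of_all _ fun ξ => (norm_symbolAct t ξ (f ξ)).symm)

/-- The group `e^{-itγ⟨i∇⟩} = 𝓕⁻ exp(-itγ⟨2πξ⟩) 𝓕` on `L²(ℝ^N, ℂ²)`. -/
def group {N : ℕ} (t : ℝ) (u : L2 N 2) : L2 N 2 :=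
  𝓕⁻ ((memLp_symbolAct t (𝓕 u)).toLp (fun ξ => symbolAct t ξ ((𝓕 u : L2 N 2) ξ)))

end HalfWave

end

/-!
The group acts by the scalar Fourier multipliers `exp(∓itω(D))`, `ω(ξ) = ⟨2πξ⟩`, on the two
eigenspaces of `γ` (`group_coe`), so everything reduces to multipliers `a(D)` acting on derivatives
of a function of the space. The estimates hold for families of symbols whose derivatives are all
`O(⟨ξ⟩^r)` with uniform constants (`IsSymbol`). For `t` in a bounded interval the propagators
`exp(itω)` form such a family of order `0` and their difference quotients in time one of
order `1`, because all the derivatives of `ω` are bounded (`isSymbol_propagator`,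
`isSymbol_propagatorSlope`).

*Weights.* The commutator of a coordinate `x_i` with `a(D)` is a multiple of `(∂_i a)(D)`, and
`⟨x⟩ = ⟨x⟩⁻¹ + ∑ (x_i ⟨x⟩⁻¹) x_i`. Hence a bound `L^p → L^q` for all symbols of order `r` implies
the same bound with the weight `⟨x⟩^n` on both sides, by induction on `n`
(`exists_wNorm_fourierMultiplierCLM_le`). The unweighted bounds are `L² → L²` for order `0`
(Plancherel), `L² → L^∞` for orders less than `-N/2` (the symbol is square integrable) and
`L^∞ → L^∞` for orders less than `-N` (the kernel is integrable).

*Sup norms.* The identity `1 = ⟨ξ⟩^{-2L} + ∑ ξ_j ρ_j(ξ)`, with `ρ_j` of order `-1`, splits `a(D)v`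
into a part of order `r - 2L`, which is controlled by `v` itself in either of the two weighted
norms, and multipliers of order `r - 1` applied to the derivatives `∂_j v`. Repeating this for
`v = D^β u` until `J` derivatives have been reached, where `k > N/2` orders of decay suffice for
`L² → L^∞`, proves `exists_wNorm_top_le`: the weighted sup norm of `a(D) D^β u` is bounded by the
norm of `u` if `a` has order at most `J - |β| - k`. With `J = 2m + 2 + k` this covers the
propagators and their difference quotients for `|β| ≤ 2m`, and so the bounds for the group, the
Lipschitz bound, and the continuity in time of the weighted sup norms.

*Continuity in `L²`.* The top order derivatives are only strongly continuous in time: the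
difference of two propagators is bounded of order `0` and tends to zero like `t - s` in the symbols
of order `1`, so dominated convergence applies after Plancherel, and the induction on the weight
goes through as before (`tendsto_wNorm_two`).
-/

noncomputable section

namespace HalfWave

/-! ### Symbol classes -/

theorem one_le_bracket {N : ℕ} (x : Rn N) : 1 ≤ bracket x :=
  Real.one_le_rpow (by nlinarith [sq_nonneg ‖x‖]) (by norm_num)

theorem bracket_pos {N : ℕ} (x : Rn N) : 0 < bracket x := one_pos.trans_le (one_le_bracket x)

theorem bracket_rpow {N : ℕ} (x : Rn N) (r : ℝ) : bracket x ^ r = (1 + ‖x‖ ^ 2) ^ (r / 2) := by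
  rw [bracket, ← Real.rpow_mul (by positivity)]
  ring_nf

theorem bracket_sq {N : ℕ} (x : Rn N) : bracket x ^ 2 = 1 + ‖x‖ ^ 2 := by
  rw [bracket, ← Real.rpow_natCast, ← Real.rpow_mul (by positivity)]
  norm_num

theorem norm_le_bracket {N : ℕ} (x : Rn N) : ‖x‖ ≤ bracket x := by
  have := bracket_sq x
  nlinarith [norm_nonneg x, bracket_pos x]

section Symbols

variable {ι : Type*} {N : ℕ} {F G : Type*} [NormedAddCommGroup F] [NormedSpace ℝ F]
  [NormedAddCommGroup G] [NormedSpace ℝ G]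

/-- A family `(a_t)` of smooth functions on `ℝ^N` all of whose derivatives of order at most `L` are
`O(⟨x⟩^r)`, uniformly in `t`. -/
def SymbolBound (L : ℕ) (r : ℝ) (a : ι → Rn N → F) : Prop :=
  (∀ t, ContDiff ℝ ((⊤ : ℕ∞) : WithTop ℕ∞) (a t)) ∧
    ∀ l ≤ L, ∃ C, ∀ t x, ‖iteratedFDeriv ℝ l (a t) x‖ ≤ C * bracket x ^ r

/-- A family `(a_t)` of symbols of order `r`, uniformly in `t`. No decay is required of
the derivatives: this is the class `S^r_{0,0}` of symbols that depend on the frequency only. -/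
def IsSymbol (r : ℝ) (a : ι → Rn N → F) : Prop := ∀ L, SymbolBound L r a

namespace SymbolBound

variable {L : ℕ} {r s : ℝ}

theorem mono_order {a : ι → Rn N → F} (h : SymbolBound L r a) (hrs : r ≤ s) :
    SymbolBound L s a := by
  refine ⟨h.1, fun l hl => ?_⟩
  obtain ⟨C, hC⟩ := h.2 l hl
  refine ⟨|C|, fun t x => (hC t x).trans ?_⟩
  have := bracket_pos x
  gcongr
  · exact le_abs_self C
  · exact one_le_bracket x

theorem add {a b : ι → Rn N → F} (ha : SymbolBound L r a) (hb : SymbolBound L r b) :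
    SymbolBound L r (fun t x => a t x + b t x) := by
  refine ⟨fun t => (ha.1 t).add (hb.1 t), fun l hl => ?_⟩
  obtain ⟨C, hC⟩ := ha.2 l hl
  obtain ⟨D, hD⟩ := hb.2 l hl
  refine ⟨C + D, fun t x => ?_⟩
  have : iteratedFDeriv ℝ l (fun x => a t x + b t x) x
      = iteratedFDeriv ℝ l (a t) x + iteratedFDeriv ℝ l (b t) x :=
    iteratedFDeriv_add_apply ((ha.1 t).of_le (by exact_mod_cast le_top)).contDiffAt
      ((hb.1 t).of_le (by exact_mod_cast le_top)).contDiffAt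
  rw [this, add_mul]
  exact (norm_add_le _ _).trans (add_le_add (hC t x) (hD t x))

theorem clm_comp {a : ι → Rn N → F} (ha : SymbolBound L r a) (A : F →L[ℝ] G) :
    SymbolBound L r (fun t x => A (a t x)) := by
  refine ⟨fun t => A.contDiff.comp (ha.1 t), fun l hl => ?_⟩
  obtain ⟨C, hC⟩ := ha.2 l hl
  refine ⟨‖A‖ * C, fun t x => ?_⟩
  have := A.norm_iteratedFDeriv_comp_left (x := x) (n := l) (N := l)
    ((ha.1 t).of_le (by exact_mod_cast le_top)).contDiffAt le_rfl
  refine this.trans ?_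
  rw [mul_assoc]
  exact mul_le_mul_of_nonneg_left (hC t x) (norm_nonneg _)

theorem smul {𝕜 : Type*} [RCLike 𝕜] [NormedSpace 𝕜 F] [IsScalarTower ℝ 𝕜 F]
    {a : ι → Rn N → 𝕜} {b : ι → Rn N → F} (ha : SymbolBound L r a) (hb : SymbolBound L s b) :
    SymbolBound L (r + s) (fun t x => a t x • b t x) := by
  refine ⟨fun t => (ha.1 t).smul (hb.1 t), fun l hl => ?_⟩
  choose! C hC using ha.2
  choose! D hD using hb.2
  refine ⟨∑ i ∈ Finset.range (l + 1), (l.choose i : ℝ) * |C i| * |D (l - i)|, fun t x => ?_⟩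
  refine (norm_iteratedFDeriv_smul_le (ha.1 t) (hb.1 t) x
    (by exact_mod_cast le_top)).trans ?_
  rw [Finset.sum_mul]
  have hx := bracket_pos x
  refine Finset.sum_le_sum fun i hi => ?_
  have hi' : i ≤ l := by simpa [Nat.lt_succ_iff] using hi
  have h1 : ‖iteratedFDeriv ℝ i (a t) x‖ ≤ |C i| * bracket x ^ r :=
    (hC i (hi'.trans hl) t x).trans (by gcongr; exact le_abs_self _)
  have h2 : ‖iteratedFDeriv ℝ (l - i) (b t) x‖ ≤ |D (l - i)| * bracket x ^ s :=
    (hD (l - i) ((Nat.sub_le _ _).trans hl) t x).trans (by gcongr; exact le_abs_self _)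
  calc _ ≤ (l.choose i : ℝ) * (|C i| * bracket x ^ r) * (|D (l - i)| * bracket x ^ s) := by
        gcongr
    _ = _ := by rw [Real.rpow_add hx]; ring

/-- Bounds for the derivatives follow recursively: it suffices to bound `a` itself and to know that
its differential belongs to the class. Since the orders are counted by `L`, the differential may be
expressed through `a`. -/
theorem of_fderiv {a : ι → Rn N → F} (h0 : ∀ t, ContDiff ℝ ((⊤ : ℕ∞) : WithTop ℕ∞) (a t))
    (hb : ∃ C, ∀ t x, ‖a t x‖ ≤ C * bracket x ^ r)
    (h1 : SymbolBound L r (fun t x => fderiv ℝ (a t) x)) : SymbolBound (L + 1) r a := by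
  refine ⟨h0, fun l hl => ?_⟩
  rcases l with _ | l
  · simpa using hb
  · obtain ⟨C, hC⟩ := h1.2 l (by omega)
    exact ⟨C, fun t x => by rw [← norm_iteratedFDeriv_fderiv]; exact hC t x⟩

theorem zero_of_bound {a : ι → Rn N → F}
    (h0 : ∀ t, ContDiff ℝ ((⊤ : ℕ∞) : WithTop ℕ∞) (a t))
    (hb : ∃ C, ∀ t x, ‖a t x‖ ≤ C * bracket x ^ r) : SymbolBound 0 r a :=
  ⟨h0, fun l hl => by obtain rfl := Nat.le_zero.1 hl; simpa using hb⟩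

end SymbolBound

namespace IsSymbol

variable {r s : ℝ}

theorem contDiff {a : ι → Rn N → F} (h : IsSymbol r a) (t : ι) :
    ContDiff ℝ ((⊤ : ℕ∞) : WithTop ℕ∞) (a t) := (h 0).1 t

theorem bound {a : ι → Rn N → F} (h : IsSymbol r a) :
    ∃ C, 0 < C ∧ ∀ t x, ‖a t x‖ ≤ C * bracket x ^ r := by
  obtain ⟨C, hC⟩ := (h 0).2 0 le_rfl
  refine ⟨|C| + 1, by positivity, fun t x => ?_⟩
  have := hC t x
  simp only [norm_iteratedFDeriv_zero] at this
  refine this.trans ?_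
  have := bracket_pos x
  gcongr
  linarith [le_abs_self C]

theorem mono {a : ι → Rn N → F} (h : IsSymbol r a) (hrs : r ≤ s) : IsSymbol s a :=
  fun L => (h L).mono_order hrs

theorem add {a b : ι → Rn N → F} (ha : IsSymbol r a) (hb : IsSymbol r b) :
    IsSymbol r (fun t x => a t x + b t x) := fun L => (ha L).add (hb L)

theorem clm_comp {a : ι → Rn N → F} (ha : IsSymbol r a) (A : F →L[ℝ] G) :
    IsSymbol r (fun t x => A (a t x)) := fun L => (ha L).clm_comp A

theorem smul {𝕜 : Type*} [RCLike 𝕜] [NormedSpace 𝕜 F] [IsScalarTower ℝ 𝕜 F]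
    {a : ι → Rn N → 𝕜} {b : ι → Rn N → F} (ha : IsSymbol r a) (hb : IsSymbol s b) :
    IsSymbol (r + s) (fun t x => a t x • b t x) := fun L => (ha L).smul (hb L)

theorem mul {a b : ι → Rn N → ℂ} (ha : IsSymbol r a) (hb : IsSymbol s b) :
    IsSymbol (r + s) (fun t x => a t x * b t x) := fun L => (ha L).smul (hb L)

theorem fderiv {a : ι → Rn N → F} (ha : IsSymbol r a) :
    IsSymbol r (fun t x => fderiv ℝ (a t) x) := by
  refine fun L => ⟨fun t => (ha.contDiff t).fderiv_right (by simp), fun l hl => ?_⟩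
  obtain ⟨C, hC⟩ := (ha (l + 1)).2 (l + 1) le_rfl
  refine ⟨C, fun t x => ?_⟩
  exact norm_iteratedFDeriv_fderiv.trans_le (hC t x)

theorem fderiv_apply {a : ι → Rn N → F} (ha : IsSymbol r a) (v : Rn N) :
    IsSymbol r (fun t x => _root_.fderiv ℝ (a t) x v) :=
  ha.fderiv.clm_comp (ContinuousLinearMap.apply ℝ F v)

theorem const (c : ι → F) (hc : ∃ C, ∀ t, ‖c t‖ ≤ C) :
    IsSymbol 0 (fun t (_ : Rn N) => c t) := by
  obtain ⟨C, hC⟩ := hc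
  refine fun L => ⟨fun t => contDiff_const, fun l _ => ⟨|C|, fun t x => ?_⟩⟩
  rcases l with _ | l
  · simpa using (hC t).trans (le_abs_self C)
  · simp [iteratedFDeriv_succ_const]

theorem sum {κ : Type*} {s : Finset κ} {a : κ → ι → Rn N → F} (ha : ∀ i ∈ s, IsSymbol r (a i)) :
    IsSymbol r (fun t x => ∑ i ∈ s, a i t x) := by
  classical
  induction s using Finset.induction_on with
  | empty =>
    refine fun L => ⟨fun t => by simpa using contDiff_const, fun l _ => ⟨0, fun t x => ?_⟩⟩
    rcases l with _ | l
    · simp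
    · simp
  | insert i s hi ih =>
    simp only [Finset.sum_insert hi]
    exact (ha i (by simp)).add (ih fun j hj => ha j (by simp [hj]))

theorem hasTemperateGrowth {a : ι → Rn N → F} (ha : IsSymbol r a) (t : ι) :
    (a t).HasTemperateGrowth := by
  refine ⟨ha.contDiff t, fun n => ?_⟩
  obtain ⟨C, hC⟩ := (ha n).2 n le_rfl
  refine ⟨⌈r⌉₊, |C|, fun x => (hC t x).trans ?_⟩
  have hx := bracket_pos x
  have h1 : bracket x ^ r ≤ bracket x ^ (⌈r⌉₊ : ℝ) :=
    Real.rpow_le_rpow_of_exponent_le (one_le_bracket x) (Nat.le_ceil r)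
  have h2 : bracket x ≤ 1 + ‖x‖ := by
    have := bracket_sq x
    nlinarith [norm_nonneg x]
  rw [Real.rpow_natCast] at h1
  calc C * bracket x ^ r ≤ |C| * bracket x ^ r := by gcongr; exact le_abs_self C
    _ ≤ |C| * (1 + ‖x‖) ^ ⌈r⌉₊ := by
      gcongr
      exact h1.trans (by gcongr)

/-- Linear functions are symbols of order `1`. -/
theorem linear (A : Rn N →L[ℝ] F) : IsSymbol 1 (fun (_ : ι) x => A x) := by
  intro L
  cases L with
  | zero => exact SymbolBound.zero_of_bound (fun _ => A.contDiff) ⟨‖A‖, fun _ x => by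
      rw [Real.rpow_one]
      exact (A.le_opNorm x).trans (by gcongr; exact norm_le_bracket x)⟩
  | succ L =>
    refine SymbolBound.of_fderiv (fun _ => A.contDiff) ⟨‖A‖, fun _ x => ?_⟩ ?_
    · rw [Real.rpow_one]
      exact (A.le_opNorm x).trans (by gcongr; exact norm_le_bracket x)
    · simp only [ContinuousLinearMap.fderiv]
      exact ((const (fun _ : ι => A) ⟨‖A‖, fun _ => le_rfl⟩).mono zero_le_one) L

end IsSymbol

/-- The function `(1 + c|x|²)^{s/2}`. -/
def bracketPow (c s : ℝ) (x : Rn N) : ℝ := (1 + c * ‖x‖ ^ 2) ^ (s / 2)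

theorem contDiff_bracketPow {c : ℝ} (hc : 0 ≤ c) (s : ℝ) :
    ContDiff ℝ ((⊤ : ℕ∞) : WithTop ℕ∞) (bracketPow c s : Rn N → ℝ) := by
  unfold bracketPow
  refine ContDiff.rpow_const_of_ne ?_ fun x => by positivity
  exact contDiff_const.add (contDiff_const.mul (contDiff_norm_sq ℝ))

theorem fderiv_bracketPow {c : ℝ} (hc : 0 ≤ c) (s : ℝ) (x : Rn N) :
    fderiv ℝ (bracketPow c s) x = bracketPow c (s - 2) x • ((s * c) • innerSL ℝ x) := by
  have h1 : HasFDerivAt (fun x : Rn N => 1 + c * ‖x‖ ^ 2) (c • (2 • innerSL ℝ x)) x :=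
    ((hasStrictFDerivAt_norm_sq x).hasFDerivAt.const_mul c).const_add 1
  have h2 := h1.rpow_const (p := s / 2) (Or.inl (by positivity))
  have h3 : HasFDerivAt (bracketPow c s) _ x := h2
  rw [h3.fderiv]
  ext v
  simp only [bracketPow, _root_.smul_apply, smul_eq_mul, nsmul_eq_mul]
  rw [show s / 2 - 1 = (s - 2) / 2 by ring]
  push_cast
  simp
  ring

theorem bracketPow_le {c : ℝ} (hc : 0 < c) (s : ℝ) :
    ∃ C, ∀ x : Rn N, ‖bracketPow c s x‖ ≤ C * bracket x ^ s := by
  refine ⟨max ((max 1 c) ^ (s / 2)) ((min 1 c) ^ (s / 2)), fun x => ?_⟩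
  have hm : 0 < min 1 c := by positivity
  have hM : 0 < max 1 c := by positivity
  have h0 : (0 : ℝ) < 1 + ‖x‖ ^ 2 := by positivity
  have h1 : min 1 c * (1 + ‖x‖ ^ 2) ≤ 1 + c * ‖x‖ ^ 2 := by
    nlinarith [min_le_left 1 c, min_le_right 1 c, sq_nonneg ‖x‖]
  have h2 : 1 + c * ‖x‖ ^ 2 ≤ max 1 c * (1 + ‖x‖ ^ 2) := by
    nlinarith [le_max_left 1 c, le_max_right 1 c, sq_nonneg ‖x‖]
  rw [bracketPow, Real.norm_of_nonneg (by positivity), bracket_rpow]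
  rcases le_total 0 s with hs | hs
  · calc _ ≤ (max 1 c * (1 + ‖x‖ ^ 2)) ^ (s / 2) := by gcongr
      _ = (max 1 c) ^ (s / 2) * (1 + ‖x‖ ^ 2) ^ (s / 2) := Real.mul_rpow hM.le h0.le
      _ ≤ _ := by gcongr; exact le_max_left _ _
  · calc _ ≤ (min 1 c * (1 + ‖x‖ ^ 2)) ^ (s / 2) :=
        Real.rpow_le_rpow_of_nonpos (by positivity) h1 (by linarith)
      _ = (min 1 c) ^ (s / 2) * (1 + ‖x‖ ^ 2) ^ (s / 2) := Real.mul_rpow hm.le h0.le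
      _ ≤ _ := by gcongr; exact le_max_right _ _

theorem fderiv_bracketPow_symbolBound {c : ℝ} (hc : 0 < c) {L : ℕ} {s : ℝ}
    (h : SymbolBound L (s - 2) (fun (_ : ι) => (bracketPow c (s - 2) : Rn N → ℝ))) :
    SymbolBound L (s - 1)
      (fun (_ : ι) (x : Rn N) => fderiv ℝ (bracketPow c s : Rn N → ℝ) x) := by
  simp only [fderiv_bracketPow hc.le]
  have := h.smul (IsSymbol.linear (ι := ι) ((s * c) • (innerSL ℝ : Rn N →L[ℝ] Rn N →L[ℝ] ℝ)) L)
  rw [show s - 2 + 1 = s - 1 by ring] at this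
  exact this

/-- The functions `(1 + c|x|²)^{s/2}` are treated for all `s` at once, because the differential
involves the exponent `s - 2`. -/
theorem isSymbol_bracketPow {c : ℝ} (hc : 0 < c) (s : ℝ) :
    IsSymbol s (fun (_ : ι) => (bracketPow c s : Rn N → ℝ)) := by
  intro L
  obtain ⟨C, hC⟩ := bracketPow_le (N := N) hc s
  induction L generalizing s C with
  | zero =>
    exact SymbolBound.zero_of_bound (fun _ => contDiff_bracketPow hc.le s) ⟨C, fun _ => hC⟩
  | succ L ih =>
    obtain ⟨C', hC'⟩ := bracketPow_le (N := N) hc (s - 2)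
    exact SymbolBound.of_fderiv (fun _ => contDiff_bracketPow hc.le s) ⟨C, fun _ => hC⟩
      ((fderiv_bracketPow_symbolBound hc (ih (s - 2) C' hC')).mono_order (by linarith))

/-- Differentiating `(1 + c|x|²)^{s/2}` once lowers the order by one. -/
theorem isSymbol_fderiv_bracketPow {c : ℝ} (hc : 0 < c) (s : ℝ) :
    IsSymbol (s - 1) (fun (_ : ι) (x : Rn N) => fderiv ℝ (bracketPow c s : Rn N → ℝ) x) :=
  fun L => fderiv_bracketPow_symbolBound hc (isSymbol_bracketPow hc (s - 2) L)

/-! ### The symbols of the half-wave groups -/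

/-- The dispersion relation `⟨2πξ⟩`. -/
def dispersion (ξ : Rn N) : ℝ := bracket ((2 * Real.pi) • ξ)

theorem dispersion_eq : (dispersion : Rn N → ℝ) = bracketPow ((2 * Real.pi) ^ 2) 1 := by
  ext ξ
  rw [dispersion, bracket, bracketPow, norm_smul, mul_pow, Real.norm_eq_abs, sq_abs]

theorem isSymbol_dispersion : IsSymbol 1 (fun (_ : ι) => (dispersion : Rn N → ℝ)) := by
  rw [dispersion_eq]
  exact isSymbol_bracketPow (by positivity) 1

theorem isSymbol_fderiv_dispersion :
    IsSymbol 0 (fun (_ : ι) (ξ : Rn N) => fderiv ℝ (dispersion : Rn N → ℝ) ξ) := by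
  rw [dispersion_eq]
  simpa using isSymbol_fderiv_bracketPow (ι := ι) (N := N) (c := (2 * Real.pi) ^ 2)
    (by positivity) 1

theorem contDiff_dispersion : ContDiff ℝ ((⊤ : ℕ∞) : WithTop ℕ∞) (dispersion : Rn N → ℝ) :=
  isSymbol_dispersion.contDiff (ι := Unit) ()

/-- The scalar propagator `exp(i t ⟨2πξ⟩)`. -/
def propagator (t : ℝ) (ξ : Rn N) : ℂ := Complex.exp (Complex.I * t * dispersion ξ)

theorem norm_propagator (t : ℝ) (ξ : Rn N) : ‖propagator t ξ‖ = 1 := by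
  rw [propagator, Complex.norm_exp]; simp

theorem contDiff_propagator (t : ℝ) :
    ContDiff ℝ ((⊤ : ℕ∞) : WithTop ℕ∞) (propagator t : Rn N → ℂ) := by
  unfold propagator
  exact (contDiff_const.mul (Complex.ofRealCLM.contDiff.comp contDiff_dispersion)).cexp

/-- The differential of the dispersion relation, with values in the `ℂ`-valued functionals. -/
def dispersionDeriv (ξ : Rn N) : Rn N →L[ℝ] ℂ := Complex.ofRealCLM.comp (fderiv ℝ dispersion ξ)

theorem isSymbol_dispersionDeriv :
    IsSymbol 0 (fun (_ : ι) => (dispersionDeriv : Rn N → Rn N →L[ℝ] ℂ)) :=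
  isSymbol_fderiv_dispersion.clm_comp
    (ContinuousLinearMap.compL ℝ (Rn N) ℝ ℂ Complex.ofRealCLM)

theorem hasFDerivAt_propagator (t : ℝ) (ξ : Rn N) :
    HasFDerivAt (propagator t) (propagator t ξ • ((Complex.I * t) • dispersionDeriv ξ)) ξ := by
  have h1 : HasFDerivAt (fun ξ : Rn N => (dispersion ξ : ℂ)) (dispersionDeriv ξ) ξ :=
    Complex.ofRealCLM.hasFDerivAt.comp ξ
      (contDiff_dispersion.differentiable (by simp) ξ).hasFDerivAt
  exact (h1.const_mul (Complex.I * t)).cexp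

/-- The differential of `exp(itω)` is `it exp(itω) dω` with `dω` of order `0`, so that bounds for
derivatives of order `L` give those of order `L + 1`. -/
theorem isSymbol_propagator {τ : ι → ℝ} {T : ℝ} (hτ : ∀ t, |τ t| ≤ T) :
    IsSymbol 0 (fun t => (propagator (τ t) : Rn N → ℂ)) := by
  have hb : ∃ C, ∀ (t : ι) (x : Rn N), ‖propagator (τ t) x‖ ≤ C * bracket x ^ (0 : ℝ) :=
    ⟨1, fun t x => by simp [norm_propagator]⟩
  intro L
  induction L with
  | zero => exact SymbolBound.zero_of_bound (fun t => contDiff_propagator _) hb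
  | succ L ih =>
    refine SymbolBound.of_fderiv (fun t => contDiff_propagator _) hb ?_
    simp only [fun t ξ => (hasFDerivAt_propagator (N := N) t ξ).fderiv]
    have hc := IsSymbol.const (N := N) (fun t => Complex.I * (τ t : ℂ)) ⟨T, fun t => by
      simpa using hτ t⟩
    simpa using ih.smul ((hc.smul (isSymbol_dispersionDeriv (ι := ι))) L)

/-- The difference quotient `(exp(itω) - exp(isω)) / (t - s)`, which is `0` if `t = s`. -/
def propagatorSlope (t s : ℝ) (ξ : Rn N) : ℂ :=
  ((t - s : ℝ) : ℂ)⁻¹ * (propagator t ξ - propagator s ξ)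

theorem propagatorSlope_mul (t s : ℝ) (ξ : Rn N) :
    ((t - s : ℝ) : ℂ) * propagatorSlope t s ξ = propagator t ξ - propagator s ξ := by
  rcases eq_or_ne t s with rfl | h
  · simp
  · have : ((t - s : ℝ) : ℂ) ≠ 0 := by exact_mod_cast sub_ne_zero.2 h
    rw [propagatorSlope, mul_inv_cancel_left₀ this]

theorem norm_propagatorSlope_le (t s : ℝ) (ξ : Rn N) :
    ‖propagatorSlope t s ξ‖ ≤ dispersion ξ := by
  have hω : 0 ≤ dispersion ξ := (bracket_pos _).le
  have h1 : ‖propagator t ξ - propagator s ξ‖ ≤ |t - s| * dispersion ξ := by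
    have h2 : propagator t ξ - propagator s ξ = propagator s ξ *
        (Complex.exp (Complex.I * ((t - s) * dispersion ξ : ℝ)) - 1) := by
      rw [mul_sub, mul_one, propagator, propagator, ← Complex.exp_add]
      congr 2
      push_cast
      ring
    rw [h2, norm_mul, norm_propagator, one_mul]
    refine (Real.norm_exp_I_mul_ofReal_sub_one_le).trans ?_
    rw [Real.norm_eq_abs, abs_mul, abs_of_nonneg hω]
  rcases eq_or_ne t s with rfl | h
  · simpa [propagatorSlope] using hω
  · have h3 : 0 < |t - s| := abs_pos.2 (sub_ne_zero.2 h)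
    rw [propagatorSlope, norm_mul, norm_inv, Complex.norm_real, Real.norm_eq_abs,
      inv_mul_le_iff₀ h3]
    exact h1

theorem contDiff_propagatorSlope (t s : ℝ) :
    ContDiff ℝ ((⊤ : ℕ∞) : WithTop ℕ∞) (propagatorSlope t s : Rn N → ℂ) :=
  contDiff_const.mul ((contDiff_propagator t).sub (contDiff_propagator s))

theorem fderiv_propagatorSlope (t s : ℝ) (ξ : Rn N) :
    fderiv ℝ (propagatorSlope t s) ξ =
      ((if t = s then 0 else Complex.I) * propagator t ξ) • dispersionDeriv ξ
        + propagatorSlope t s ξ • ((Complex.I * s) • dispersionDeriv ξ) := by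
  have h := (((hasFDerivAt_propagator t ξ).sub (hasFDerivAt_propagator s ξ)).const_mul
    (((t - s : ℝ) : ℂ)⁻¹)).fderiv
  have h' : fderiv ℝ (propagatorSlope t s) ξ = _ := h
  rw [h']
  ext v
  rcases eq_or_ne t s with rfl | hts
  · simp [propagatorSlope]
  · have : ((t : ℂ) - s) ≠ 0 := by exact_mod_cast sub_ne_zero.2 hts
    simp [propagatorSlope, hts]
    field_simp
    ring

/-- The difference quotient grows like `ω`, and its differential is again a combination of the
propagator and of the difference quotient, with coefficients of order `0`. -/
theorem isSymbol_propagatorSlope {τ σ : ι → ℝ} {T : ℝ} (hτ : ∀ t, |τ t| ≤ T)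
    (hσ : ∀ t, |σ t| ≤ T) :
    IsSymbol 1 (fun t => (propagatorSlope (τ t) (σ t) : Rn N → ℂ)) := by
  have hb : ∃ C, ∀ (t : ι) (x : Rn N),
      ‖propagatorSlope (τ t) (σ t) x‖ ≤ C * bracket x ^ (1 : ℝ) := by
    obtain ⟨C, -, hC⟩ := (isSymbol_dispersion (ι := Unit) (N := N)).bound
    exact ⟨C, fun t x => (norm_propagatorSlope_le _ _ x).trans
      ((le_abs_self _).trans (hC () x))⟩
  intro L
  induction L with
  | zero => exact SymbolBound.zero_of_bound (fun t => contDiff_propagatorSlope _ _) hb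
  | succ L ih =>
    refine SymbolBound.of_fderiv (fun t => contDiff_propagatorSlope _ _) hb ?_
    simp only [fun t s ξ => fderiv_propagatorSlope (N := N) t s ξ]
    have hD := isSymbol_dispersionDeriv (ι := ι) (N := N)
    have hc := IsSymbol.const (N := N) (fun t => Complex.I * (σ t : ℂ)) ⟨T, fun t => by
      simpa using hσ t⟩
    have hc' := IsSymbol.const (N := N) (fun t => if τ t = σ t then 0 else Complex.I)
      ⟨1, fun t => by split_ifs <;> simp⟩
    have h1 := ((hc'.mul (isSymbol_propagator hτ)).smul hD).mono
      (show (0 : ℝ) + 0 + 0 ≤ 1 by norm_num)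
    have h2 := ih.smul ((hc.smul hD) L)
    simp only [add_zero] at h2
    exact (h1 L).add h2

end Symbols

/-- Multiplication of distributions by a function of temperate growth. -/
local notation "𝓜" => TemperedDistribution.smulLeftCLM (Cd _)

/-- Fourier multipliers on distributions. -/
local notation "𝓐" => TemperedDistribution.fourierMultiplierCLM (Cd _)

/-! ### The `L^p` norm of a tempered distribution -/

section DistLpNorm

open scoped NNReal

variable {N d : ℕ} {p q : ℝ≥0∞} [Fact (1 ≤ p)] [Fact (1 ≤ q)]

theorem distLpNorm_coe_le (g : Lp (Cd d) p (volume : Measure (Rn N))) :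
    distLpNorm p (g : 𝓢'(Rn N, Cd d)) ≤ ‖g‖ₑ :=
  iInf₂_le (f := fun (g' : Lp (Cd d) p (volume : Measure (Rn N)))
    (_ : (g : 𝓢'(Rn N, Cd d)) = g') => ‖g'‖ₑ) g rfl

theorem distLpNorm_coe (g : Lp (Cd d) p (volume : Measure (Rn N))) :
    distLpNorm p (g : 𝓢'(Rn N, Cd d)) = ‖g‖ₑ := by
  refine le_antisymm (distLpNorm_coe_le g) (le_iInf₂ fun g' h => le_of_eq ?_)
  have hinj := LinearMap.ker_eq_bot.1
    (Lp.ker_toTemperedDistributionCLM_eq_bot (F := Cd d) (μ := (volume : Measure (Rn N)))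
      (p := p))
  rw [hinj (a₁ := g) (a₂ := g') h]

theorem exists_of_distLpNorm_ne_top {T : 𝓢'(Rn N, Cd d)} (h : distLpNorm p T ≠ ∞) :
    ∃ g : Lp (Cd d) p (volume : Measure (Rn N)), T = g := by
  by_contra! hT
  exact h (by simp [distLpNorm, hT])

/-- A bound on `L^p` functions extends to all distributions, as the norm is `∞` otherwise. -/
theorem distLpNorm_map_le {A : 𝓢'(Rn N, Cd d) → 𝓢'(Rn N, Cd d)} {C : ℝ≥0} (hC : C ≠ 0)
    (h : ∀ g : Lp (Cd d) p (volume : Measure (Rn N)),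
      distLpNorm q (A (g : 𝓢'(Rn N, Cd d))) ≤ C * ‖g‖ₑ) (T : 𝓢'(Rn N, Cd d)) :
    distLpNorm q (A T) ≤ C * distLpNorm p T := by
  by_cases hT : distLpNorm p T = ∞
  · rw [hT, ENNReal.mul_top (by exact_mod_cast hC)]
    exact le_top
  · obtain ⟨g, rfl⟩ := exists_of_distLpNorm_ne_top hT
    rw [distLpNorm_coe]
    exact h g

theorem distLpNorm_zero : distLpNorm p (0 : 𝓢'(Rn N, Cd d)) = 0 := by
  have h : (0 : 𝓢'(Rn N, Cd d)) = (0 : Lp (Cd d) p (volume : Measure (Rn N))) :=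
    (map_zero (Lp.toTemperedDistributionCLM (Cd d) (volume : Measure (Rn N)) p)).symm
  rw [h, distLpNorm_coe, enorm_zero]

theorem distLpNorm_add_le (S T : 𝓢'(Rn N, Cd d)) :
    distLpNorm p (S + T) ≤ distLpNorm p S + distLpNorm p T := by
  by_cases hS : distLpNorm p S = ∞
  · simp [hS]
  by_cases hT : distLpNorm p T = ∞
  · simp [hT]
  obtain ⟨f, rfl⟩ := exists_of_distLpNorm_ne_top hS
  obtain ⟨g, rfl⟩ := exists_of_distLpNorm_ne_top hT
  have h : (f : 𝓢'(Rn N, Cd d)) + (g : 𝓢'(Rn N, Cd d)) =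
      ((f + g : Lp (Cd d) p _) : 𝓢'(Rn N, Cd d)) :=
    (map_add (Lp.toTemperedDistributionCLM (Cd d) (volume : Measure (Rn N)) p) f g).symm
  rw [h, distLpNorm_coe, distLpNorm_coe, distLpNorm_coe]
  exact enorm_add_le f g

theorem distLpNorm_smul_le (c : ℂ) (T : 𝓢'(Rn N, Cd d)) :
    distLpNorm p (c • T) ≤ ‖c‖ₑ * distLpNorm p T := by
  rcases eq_or_ne c 0 with rfl | hc
  · have h : (0 : ℂ) • T = 0 := zero_smul ℂ T
    rw [h, distLpNorm_zero]
    exact zero_le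
  · refine distLpNorm_map_le (A := fun T => c • T) (C := ‖c‖₊) (by simpa using hc)
      (fun g => ?_) T
    have h : c • (g : 𝓢'(Rn N, Cd d)) = ((c • g : Lp (Cd d) p _) : 𝓢'(Rn N, Cd d)) :=
      (map_smul (Lp.toTemperedDistributionCLM (Cd d) (volume : Measure (Rn N)) p) c g).symm
    rw [h, distLpNorm_coe, enorm_smul]
    rfl

/-- Multiplication by a bounded function is bounded on `L^p`. -/
theorem distLpNorm_smulLeftCLM_le {g : Rn N → ℂ} (hg : g.HasTemperateGrowth) {C : ℝ≥0}
    (hC : C ≠ 0) (hb : ∀ x, ‖g x‖ ≤ C) (T : 𝓢'(Rn N, Cd d)) :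
    distLpNorm p (TemperedDistribution.smulLeftCLM (Cd d) g T) ≤ C * distLpNorm p T := by
  refine distLpNorm_map_le hC (fun f => ?_) T
  have hm : MemLp g ∞ (volume : Measure (Rn N)) :=
    memLp_top_of_bound hg.1.continuous.aestronglyMeasurable C (ae_of_all _ hb)
  rw [← Lp.toTemperedDistribution_smul_eq (r := p) hg hm, distLpNorm_coe]
  have h1 : ‖hm.toLp g • f‖ ≤ ‖hm.toLp g‖ * ‖f‖ := Lp.norm_smul_le _ _
  have h2 : ‖hm.toLp g‖ ≤ C := by
    rw [Lp.norm_toLp]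
    refine ENNReal.toReal_le_of_le_ofReal C.2 ?_
    rw [eLpNorm_exponent_top]
    exact eLpNormEssSup_le_of_ae_bound (ae_of_all _ hb)
  have h3 : ‖(hm.toLp g • f : Lp (Cd d) p (volume : Measure (Rn N)))‖₊ ≤ C * ‖f‖₊ := by
    rw [← NNReal.coe_le_coe]
    push_cast
    exact h1.trans (by gcongr)
  simpa [enorm] using (ENNReal.coe_le_coe.2 h3)

end DistLpNorm

/-! ### Weights and Fourier multipliers -/

section Weights

open scoped NNReal

variable {N d : ℕ} {p q : ℝ≥0∞} [Fact (1 ≤ p)] [Fact (1 ≤ q)]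

/-- The weight `⟨x⟩^n`, with complex values. -/
def weight (n : ℕ) (x : Rn N) : ℂ := ((bracket x ^ n : ℝ) : ℂ)

/-- The `i`-th coordinate, with complex values. -/
def coord (i : Fin N) (x : Rn N) : ℂ := ((x i : ℝ) : ℂ)

/-- The `i`-th vector of the standard basis. -/
abbrev basisVec (i : Fin N) : Rn N := EuclideanSpace.single i (1 : ℝ)

theorem coord_eq_inner (i : Fin N) :
    (coord i : Rn N → ℂ) = fun x => ((inner ℝ x (basisVec i) : ℝ) : ℂ) := by
  ext x
  simp [coord, EuclideanSpace.inner_single_right]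

theorem hasTemperateGrowth_coord (i : Fin N) : (coord i : Rn N → ℂ).HasTemperateGrowth := by
  rw [coord_eq_inner]
  fun_prop

theorem hasTemperateGrowth_bracket_zpow (s : ℤ) :
    (fun x : Rn N => ((bracket x ^ s : ℝ) : ℂ)).HasTemperateGrowth := by
  have h : (fun x : Rn N => ((bracket x ^ s : ℝ) : ℂ)) =
      fun x => (((1 + ‖x‖ ^ 2) ^ ((s : ℝ) / 2) : ℝ) : ℂ) := by
    ext x
    rw [← Real.rpow_intCast, bracket_rpow]
  rw [h]
  fun_prop

theorem hasTemperateGrowth_weight (n : ℕ) : (weight n : Rn N → ℂ).HasTemperateGrowth := by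
  have h := hasTemperateGrowth_bracket_zpow (N := N) n
  simp only [zpow_natCast] at h
  exact h

/-- The weighted norm `‖⟨x⟩^n T‖_{L^p}` of a distribution. -/
def wNorm (n : ℕ) (p : ℝ≥0∞) [Fact (1 ≤ p)] (T : 𝓢'(Rn N, Cd d)) : ℝ≥0∞ :=
  distLpNorm p (𝓜 (weight n) T)

theorem weightedNorm_eq (n : ℕ) (β : Fin N → ℕ) (u : L2 N d) :
    weightedNorm n p β u = wNorm n p (multiDeriv β (u : 𝓢'(Rn N, Cd d))) := rfl

theorem wNorm_zero_weight (T : 𝓢'(Rn N, Cd d)) : wNorm 0 p T = distLpNorm p T := by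
  have : (weight 0 : Rn N → ℂ) = fun _ => 1 := by ext; simp [weight]
  rw [wNorm, this, TemperedDistribution.smulLeftCLM_const, one_smul]

theorem wNorm_add_le (n : ℕ) (S T : 𝓢'(Rn N, Cd d)) :
    wNorm n p (S + T) ≤ wNorm n p S + wNorm n p T := by
  rw [wNorm, map_add]
  exact distLpNorm_add_le _ _

theorem wNorm_zero (n : ℕ) : wNorm n p (0 : 𝓢'(Rn N, Cd d)) = 0 := by
  rw [wNorm, map_zero, distLpNorm_zero]

theorem wNorm_sum_le {κ : Type*} (n : ℕ) (s : Finset κ) (T : κ → 𝓢'(Rn N, Cd d)) :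
    wNorm n p (∑ i ∈ s, T i) ≤ ∑ i ∈ s, wNorm n p (T i) :=
  Finset.le_sum_of_subadditive _ (wNorm_zero n).le (wNorm_add_le n) s T

theorem wNorm_smul_le (n : ℕ) (c : ℂ) (T : 𝓢'(Rn N, Cd d)) :
    wNorm n p (c • T) ≤ ‖c‖ₑ * wNorm n p T := by
  rw [wNorm, map_smul]
  exact distLpNorm_smul_le _ _

theorem smulLeftCLM_comm {g h : Rn N → ℂ} (hg : g.HasTemperateGrowth)
    (hh : h.HasTemperateGrowth) (T : 𝓢'(Rn N, Cd d)) : 𝓜 g (𝓜 h T) = 𝓜 h (𝓜 g T) := by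
  rw [TemperedDistribution.smulLeftCLM_smulLeftCLM_apply hh hg,
    TemperedDistribution.smulLeftCLM_smulLeftCLM_apply hg hh, mul_comm]

theorem wNorm_smulLeftCLM_le (n : ℕ) {g : Rn N → ℂ} (hg : g.HasTemperateGrowth)
    (hb : ∀ x, ‖g x‖ ≤ 1) (T : 𝓢'(Rn N, Cd d)) : wNorm n p (𝓜 g T) ≤ wNorm n p T := by
  rw [wNorm, smulLeftCLM_comm (hasTemperateGrowth_weight n) hg]
  refine (distLpNorm_smulLeftCLM_le (p := p) hg (C := 1) one_ne_zero (by simpa using hb)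
    (𝓜 (weight n) T)).trans ?_
  rw [ENNReal.coe_one, one_mul]
  exact le_rfl

theorem abs_coord_le_bracket (i : Fin N) (x : Rn N) : ‖coord i x‖ ≤ bracket x := by
  rw [coord, Complex.norm_real]
  exact (PiLp.norm_apply_le x i).trans (norm_le_bracket x)

theorem wNorm_le_succ (n : ℕ) (T : 𝓢'(Rn N, Cd d)) : wNorm n p T ≤ wNorm (n + 1) p T := by
  have hg := hasTemperateGrowth_bracket_zpow (N := N) (-1)
  have h : 𝓜 (weight n) T = 𝓜 (fun x : Rn N => ((bracket x ^ (-1 : ℤ) : ℝ) : ℂ))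
      (𝓜 (weight (n + 1)) T) := by
    rw [TemperedDistribution.smulLeftCLM_smulLeftCLM_apply (hasTemperateGrowth_weight _) hg]
    congr 2
    ext x
    have := (bracket_pos x).ne'
    simp only [weight, Pi.mul_apply, ← Complex.ofReal_mul]
    congr 1
    rw [zpow_neg_one]
    field_simp
    ring
  rw [wNorm, wNorm, h]
  refine (distLpNorm_smulLeftCLM_le (p := p) hg (C := 1) one_ne_zero (fun x => ?_) _).trans
    (by simp)
  rw [Complex.norm_real, zpow_neg_one, Real.norm_of_nonneg (inv_pos.2 (bracket_pos x)).le]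
  exact inv_le_one_of_one_le₀ (one_le_bracket x)

theorem wNorm_coord_le (n : ℕ) (i : Fin N) (T : 𝓢'(Rn N, Cd d)) :
    wNorm n p (𝓜 (coord i) T) ≤ wNorm (n + 1) p T := by
  have hb := hasTemperateGrowth_bracket_zpow (N := N) (-1)
  have hc := hasTemperateGrowth_coord (N := N) i
  have hg : (fun x : Rn N => ((bracket x ^ (-1 : ℤ) : ℝ) : ℂ) * coord i x).HasTemperateGrowth :=
    hb.mul hc
  have h : 𝓜 (weight n) (𝓜 (coord i) T)
      = 𝓜 (fun x : Rn N => ((bracket x ^ (-1 : ℤ) : ℝ) : ℂ) * coord i x)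
      (𝓜 (weight (n + 1)) T) := by
    rw [TemperedDistribution.smulLeftCLM_smulLeftCLM_apply (hasTemperateGrowth_weight _) hg,
      TemperedDistribution.smulLeftCLM_smulLeftCLM_apply hc (hasTemperateGrowth_weight _)]
    congr 2
    ext x
    have : (bracket x : ℂ) ≠ 0 := by exact_mod_cast (bracket_pos x).ne'
    simp only [weight, Pi.mul_apply]
    push_cast
    rw [zpow_neg_one]
    field_simp
    ring
  rw [wNorm, wNorm, h]
  refine (distLpNorm_smulLeftCLM_le (p := p) hg (C := 1) one_ne_zero (fun x => ?_) _).trans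
    (by simp)
  rw [norm_mul, Complex.norm_real, zpow_neg_one,
    Real.norm_of_nonneg (inv_pos.2 (bracket_pos x)).le, NNReal.coe_one,
    inv_mul_le_iff₀ (bracket_pos x), mul_one]
  exact abs_coord_le_bracket i x

/-- One power of the weight is traded for multiplication by the coordinates, because
`⟨x⟩ = ⟨x⟩⁻¹ + ∑ᵢ (xᵢ⟨x⟩⁻¹) xᵢ`. -/
theorem wNorm_succ_le (n : ℕ) (T : 𝓢'(Rn N, Cd d)) :
    wNorm (n + 1) p T ≤ wNorm n p T + ∑ i, wNorm n p (𝓜 (coord i) T) := by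
  set b : Rn N → ℂ := fun x => ((bracket x ^ (-1 : ℤ) : ℝ) : ℂ) with hb_def
  have hb : b.HasTemperateGrowth := hasTemperateGrowth_bracket_zpow (-1)
  have hc := hasTemperateGrowth_coord (N := N)
  have hw := hasTemperateGrowth_weight (N := N) n
  have hbn : ∀ x, ‖b x‖ = (bracket x)⁻¹ := fun x => by
    rw [hb_def, Complex.norm_real, zpow_neg_one,
      Real.norm_of_nonneg (inv_pos.2 (bracket_pos x)).le]
  have h : 𝓜 (weight (n + 1)) T =
      𝓜 (weight n) (𝓜 b T + ∑ i, 𝓜 (b * coord i) (𝓜 (coord i) T)) := by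
    have h1 : ∀ i ∈ (Finset.univ : Finset (Fin N)), (coord i * (b * coord i)).HasTemperateGrowth := fun i _ =>
      (hc i).mul (hb.mul (hc i))
    have h2 : ∑ i, 𝓜 (b * coord i) (𝓜 (coord i) T)
        = 𝓜 (fun x => ∑ i, (coord i * (b * coord i) : Rn N → ℂ) x) T := by
      rw [TemperedDistribution.smulLeftCLM_sum h1, _root_.sum_apply]
      exact Finset.sum_congr rfl fun i _ =>
        TemperedDistribution.smulLeftCLM_smulLeftCLM_apply (hc i) (hb.mul (hc i)) T
    have h3 : (fun x : Rn N => ∑ i, (coord i * (b * coord i) : Rn N → ℂ) x).HasTemperateGrowth :=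
      .sum h1
    rw [h2, ← _root_.add_apply, ← TemperedDistribution.smulLeftCLM_add hb h3,
      TemperedDistribution.smulLeftCLM_smulLeftCLM_apply (hb.add h3) hw]
    congr 2
    ext x
    have hx : (bracket x : ℂ) ≠ 0 := by exact_mod_cast (bracket_pos x).ne'
    have hsum : ∑ i, (coord i * (b * coord i) : Rn N → ℂ) x = b x * (‖x‖ ^ 2 : ℝ) := by
      rw [EuclideanSpace.norm_sq_eq]
      push_cast
      rw [Finset.mul_sum]
      refine Finset.sum_congr rfl fun i _ => ?_
      simp only [Pi.mul_apply, coord, Real.norm_eq_abs, ← Complex.ofReal_pow, sq_abs]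
      push_cast
      ring
    have hsq : (bracket x : ℂ) ^ 2 = 1 + ((‖x‖ ^ 2 : ℝ) : ℂ) := by
      exact_mod_cast bracket_sq x
    simp only [Pi.mul_apply, Pi.add_apply]
    simp only [Pi.mul_apply] at hsum
    rw [hsum, ← mul_one_add, ← hsq]
    simp only [weight, hb_def]
    push_cast
    rw [zpow_neg_one]
    field_simp
    ring
  rw [wNorm, h]
  refine (wNorm_add_le n _ _).trans (add_le_add ?_ ((wNorm_sum_le n _ _).trans
    (Finset.sum_le_sum fun i _ => ?_)))
  · refine wNorm_smulLeftCLM_le n hb (fun x => ?_) T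
    rw [hbn]
    exact inv_le_one_of_one_le₀ (one_le_bracket x)
  · refine wNorm_smulLeftCLM_le n (hb.mul (hc i)) (fun x => ?_) _
    rw [Pi.mul_apply, norm_mul, hbn, inv_mul_le_iff₀ (bracket_pos x), mul_one]
    exact abs_coord_le_bracket i x

theorem hasTemperateGrowth_fderiv_apply {g : Rn N → ℂ} (hg : g.HasTemperateGrowth) (v : Rn N) :
    (fun x => fderiv ℝ g x v).HasTemperateGrowth := by
  have h1 : (fderiv ℝ g).HasTemperateGrowth := by
    refine ⟨hg.1.fderiv_right (by simp), fun n => ?_⟩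
    obtain ⟨k, C, h⟩ := hg.2 (n + 1)
    exact ⟨k, C, fun x => by rw [norm_iteratedFDeriv_fderiv]; exact h x⟩
  exact (ContinuousLinearMap.apply ℝ ℂ v).hasTemperateGrowth.comp h1

/-- The product rule for a distribution and a function of temperate growth. -/
theorem lineDeriv_smulLeftCLM {g : Rn N → ℂ} (hg : g.HasTemperateGrowth) (v : Rn N)
    (T : 𝓢'(Rn N, Cd d)) :
    ∂_{v} (𝓜 g T) = 𝓜 (fun x => fderiv ℝ g x v) T + 𝓜 g (∂_{v} T) := by
  ext1 φ
  have hg' := hasTemperateGrowth_fderiv_apply hg v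
  have h : ∂_{v} (SchwartzMap.smulLeftCLM ℂ g φ) =
      SchwartzMap.smulLeftCLM ℂ (fun x => fderiv ℝ g x v) φ
        + SchwartzMap.smulLeftCLM ℂ g (∂_{v} φ) := by
    ext x
    have h1 : HasFDerivAt g (fderiv ℝ g x) x := (hg.1.differentiable (by simp) x).hasFDerivAt
    have h2 : HasFDerivAt φ (fderiv ℝ φ x) x := φ.differentiableAt.hasFDerivAt
    have h3 : ⇑(SchwartzMap.smulLeftCLM ℂ g φ) = fun x => g x • φ x := by
      ext x; rw [SchwartzMap.smulLeftCLM_apply_apply hg]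
    rw [SchwartzMap.lineDerivOp_apply_eq_fderiv, _root_.add_apply,
      SchwartzMap.smulLeftCLM_apply_apply hg', SchwartzMap.smulLeftCLM_apply_apply hg,
      SchwartzMap.lineDerivOp_apply_eq_fderiv, h3,
      HasFDerivAt.fderiv (f := fun x => g x • φ x) (h1.smul h2)]
    simp [add_comm]
  have h' : (∂_{v} (𝓜 g T)) φ = T (SchwartzMap.smulLeftCLM ℂ g (-∂_{v} φ)) := rfl
  have h'' : (𝓜 g (∂_{v} T)) φ = T (-∂_{v} (SchwartzMap.smulLeftCLM ℂ g φ)) := rfl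
  have h''' : (𝓜 (fun x => fderiv ℝ g x v) T + 𝓜 g (∂_{v} T)) φ
    = T (SchwartzMap.smulLeftCLM ℂ (fun x => fderiv ℝ g x v) φ) + (𝓜 g (∂_{v} T)) φ := rfl
  rw [h', h''', h'', h, ← map_add]
  congr 1
  rw [map_neg]
  abel

/-- The commutator of a coordinate with a Fourier multiplier is, up to a constant, the multiplier
of the differentiated symbol. -/
theorem coord_fourierMultiplierCLM {a : Rn N → ℂ} (ha : a.HasTemperateGrowth) (i : Fin N)
    (T : 𝓢'(Rn N, Cd d)) :
    𝓜 (coord i) (𝓐 a T) = 𝓐 a (𝓜 (coord i) T)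
      - (2 * Real.pi * Complex.I)⁻¹ • 𝓐 (fun ξ => fderiv ℝ a ξ (basisVec i)) T := by
  have hpi : (2 * Real.pi * Complex.I : ℂ) ≠ 0 := by simp [Real.pi_ne_zero]
  have h1 := TemperedDistribution.lineDerivOp_fourier_eq (𝓐 a T) (basisVec i)
  have h2 := TemperedDistribution.lineDerivOp_fourier_eq T (basisVec i)
  rw [← coord_eq_inner] at h1 h2
  have h3 : 𝓕 (𝓐 a T) = 𝓜 a (𝓕 T) := by
    rw [TemperedDistribution.fourierMultiplierCLM_apply, fourier_fourierInv_eq]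
  rw [h3, lineDeriv_smulLeftCLM ha, h2] at h1
  have h4 := congrArg (fun S : 𝓢'(Rn N, Cd d) => 𝓕⁻ S) h1
  simp only [fourierInv_fourier_eq] at h4
  rw [FourierTransform.fourierInv_add, FourierTransform.fourier_smul, map_smul,
    FourierTransform.fourierInv_smul, ← TemperedDistribution.fourierMultiplierCLM_apply,
    ← TemperedDistribution.fourierMultiplierCLM_apply] at h4
  have h5 := congrArg (fun S => (-(2 * Real.pi * Complex.I : ℂ)⁻¹) • S) h4
  simp only [smul_add, smul_smul, neg_mul_neg, inv_mul_cancel₀ hpi, one_smul] at h5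
  rw [← h5, neg_smul]
  abel

theorem wNorm_coord_fourierMultiplierCLM_le (n : ℕ) {a : Rn N → ℂ} (ha : a.HasTemperateGrowth)
    (i : Fin N) (T : 𝓢'(Rn N, Cd d)) :
    wNorm n q (𝓜 (coord i) (𝓐 a T)) ≤ wNorm n q (𝓐 a (𝓜 (coord i) T))
      + wNorm n q (𝓐 (fun ξ => fderiv ℝ a ξ (basisVec i)) T) := by
  rw [coord_fourierMultiplierCLM ha, sub_eq_add_neg, ← neg_smul]
  refine (wNorm_add_le n _ _).trans (add_le_add le_rfl ((wNorm_smul_le n _ _).trans ?_))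
  refine mul_le_of_le_one_left zero_le ?_
  rw [enorm_neg, ← ofReal_norm, ENNReal.ofReal_le_one, norm_inv]
  refine inv_le_one_of_one_le₀ ?_
  simp only [norm_mul, Complex.norm_I, Complex.norm_real, Complex.norm_ofNat, mul_one,
    Real.norm_eq_abs, abs_of_pos Real.pi_pos]
  linarith [Real.pi_gt_three]

/-- If all families of symbols of order `r` map `L^p` to `L^q`, then they do so with the
weight `⟨x⟩^n` on both sides. -/
theorem exists_wNorm_fourierMultiplierCLM_le {ι : Type*} {r : ℝ}
    (base : ∀ a : ι → Rn N → ℂ, IsSymbol r a → ∃ C : ℝ≥0, ∀ t (T : 𝓢'(Rn N, Cd d)),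
      distLpNorm q (𝓐 (a t) T) ≤ C * distLpNorm p T)
    (n : ℕ) (a : ι → Rn N → ℂ) (ha : IsSymbol r a) :
    ∃ C : ℝ≥0, ∀ t (T : 𝓢'(Rn N, Cd d)), wNorm n q (𝓐 (a t) T) ≤ C * wNorm n p T := by
  induction n generalizing a with
  | zero => simpa only [wNorm_zero_weight] using base a ha
  | succ n ih =>
    obtain ⟨C, hC⟩ := ih a ha
    choose D hD using fun i => ih _ (ha.fderiv_apply (basisVec i))
    refine ⟨C + ∑ i, (C + D i), fun t T => (wNorm_succ_le n _).trans ?_⟩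
    push_cast
    rw [add_mul, Finset.sum_mul]
    refine add_le_add ((hC t T).trans (by gcongr; exact wNorm_le_succ n T))
      (Finset.sum_le_sum fun i _ => ?_)
    refine (wNorm_coord_fourierMultiplierCLM_le n (ha.hasTemperateGrowth t) i T).trans ?_
    rw [add_mul]
    refine add_le_add ((hC t _).trans (by gcongr; exact wNorm_coord_le n i T))
      ((hD i t T).trans (by gcongr; exact wNorm_le_succ n T))

end Weights

/-! ### Fourier multipliers without weights -/

section BaseBounds

open scoped NNReal

variable {N d : ℕ}

theorem distLpNorm_fourier_le (T : 𝓢'(Rn N, Cd d)) : distLpNorm 2 (𝓕 T) ≤ distLpNorm 2 T := by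
  refine (distLpNorm_map_le (p := 2) (A := fun T => 𝓕 T) (C := 1) one_ne_zero (fun g => ?_) T).trans
    (by rw [ENNReal.coe_one, one_mul])
  rw [Lp.fourier_toTemperedDistribution_eq, distLpNorm_coe, ENNReal.coe_one, one_mul,
    ← ofReal_norm, ← ofReal_norm, Lp.norm_fourier_eq]

theorem distLpNorm_fourierInv_le (T : 𝓢'(Rn N, Cd d)) :
    distLpNorm 2 (𝓕⁻ T) ≤ distLpNorm 2 T := by
  refine (distLpNorm_map_le (p := 2) (A := fun T => 𝓕⁻ T) (C := 1) one_ne_zero (fun g => ?_) T).trans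
    (by rw [ENNReal.coe_one, one_mul])
  have h : ‖𝓕⁻ g‖ = ‖g‖ := by
    rw [← Lp.norm_fourier_eq, fourier_fourierInv_eq]
  rw [Lp.fourierInv_toTemperedDistribution_eq, distLpNorm_coe, ENNReal.coe_one, one_mul,
    ← ofReal_norm, ← ofReal_norm, h]

/-- Symbols of order `0` are bounded on `L²`, by Plancherel. -/
theorem exists_distLpNorm_two_le {ι : Type*} (a : ι → Rn N → ℂ) (ha : IsSymbol 0 a) :
    ∃ C : ℝ≥0, ∀ t (T : 𝓢'(Rn N, Cd d)), distLpNorm 2 (𝓐 (a t) T) ≤ C * distLpNorm 2 T := by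
  obtain ⟨C, hC, h⟩ := ha.bound
  refine ⟨C.toNNReal, fun t T => ?_⟩
  refine (distLpNorm_fourierInv_le _).trans ((distLpNorm_smulLeftCLM_le (p := 2)
    (ha.hasTemperateGrowth t) (Real.toNNReal_pos.2 hC).ne'
    (fun x => by simpa [Real.coe_toNNReal C hC.le] using h t x) _).trans ?_)
  gcongr
  exact distLpNorm_fourier_le T

theorem integrable_bracket_rpow {r : ℝ} (hr : r < -N) :
    Integrable (fun x : Rn N => bracket x ^ r) := by
  have h := integrable_rpow_neg_one_add_norm_sq (E := Rn N) (μ := volume) (r := -r)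
    (by simpa using lt_neg_of_lt_neg hr)
  simpa only [neg_neg, bracket_rpow] using h

theorem memLp_bracket_rpow {r : ℝ} (hr : 2 * r < -N) :
    MemLp (fun x : Rn N => bracket x ^ r) 2 := by
  have hc : Continuous (fun x : Rn N => bracket x ^ r) :=
    continuous_bracket.rpow_const fun x => Or.inl (bracket_pos x).ne'
  rw [memLp_two_iff_integrable_sq hc.aestronglyMeasurable]
  refine (integrable_bracket_rpow hr).congr (ae_of_all _ fun x => ?_)
  simp only
  rw [← Real.rpow_natCast, ← Real.rpow_mul (bracket_pos x).le]
  congr 1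
  push_cast
  ring

theorem distLpNorm_one_smulLeftCLM_le {g : Rn N → ℂ} (hg : g.HasTemperateGrowth)
    (hm : MemLp g 2 (volume : Measure (Rn N))) {C : ℝ≥0} (hC : C ≠ 0)
    (hb : eLpNorm g 2 volume ≤ C) (T : 𝓢'(Rn N, Cd d)) :
    distLpNorm 1 (𝓜 g T) ≤ C * distLpNorm 2 T := by
  refine distLpNorm_map_le hC (fun f => ?_) T
  rw [← Lp.toTemperedDistribution_smul_eq (r := 1) hg hm, distLpNorm_coe]
  have h1 : ‖(hm.toLp g • f : Lp (Cd d) 1 (volume : Measure (Rn N)))‖ ≤ ‖hm.toLp g‖ * ‖f‖ :=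
    Lp.norm_smul_le _ _
  have h2 : ‖hm.toLp g‖ₑ ≤ C := by rwa [Lp.enorm_toLp]
  rw [← ofReal_norm]
  refine (ENNReal.ofReal_le_ofReal h1).trans ?_
  rw [ENNReal.ofReal_mul (norm_nonneg _), ofReal_norm, ofReal_norm]
  gcongr

/-- The inverse Fourier transform maps `L¹` to `L^∞`, also in the sense of distributions. -/
theorem distLpNorm_top_fourierInv_le (T : 𝓢'(Rn N, Cd d)) :
    distLpNorm ∞ (𝓕⁻ T) ≤ distLpNorm 1 T := by
  refine (distLpNorm_map_le (p := 1) (A := fun T => 𝓕⁻ T) (C := 1) one_ne_zero (fun v => ?_) T).trans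
    (by rw [ENNReal.coe_one, one_mul])
  set h := Real.Lp.fourierTransformInv v with h_def
  have hb : ∀ x, ‖h x‖ ≤ ‖v‖ := fun x => by
    rw [h_def, Real.Lp.fourierTransformInv_apply, Real.fourierInv_eq]
    refine (norm_integral_le_integral_norm _).trans ?_
    simp_rw [Circle.norm_smul]
    exact (L1.norm_eq_integral_norm v).symm.le
  have hm : MemLp h ∞ (volume : Measure (Rn N)) :=
    memLp_top_of_bound h.continuous.aestronglyMeasurable ‖v‖ (ae_of_all _ hb)
  have heq : 𝓕⁻ (v : 𝓢'(Rn N, Cd d)) = (hm.toLp h : 𝓢'(Rn N, Cd d)) := by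
    ext1 φ
    rw [TemperedDistribution.fourierInv_apply, Lp.toTemperedDistribution_apply,
      Lp.toTemperedDistribution_apply]
    have h1 : ∫ x, φ x • (hm.toLp h) x = ∫ x, φ x • h x := by
      refine integral_congr_ae ?_
      filter_upwards [hm.coeFn_toLp] with x hx
      rw [hx]
    rw [h1]
    have h2 := VectorFourier.integral_fourierIntegral_smul_eq_flip (L := -innerₗ (Rn N))
      (μ := volume) (ν := volume) Real.continuous_fourierChar
      (by simpa using! continuous_inner.neg) φ.integrable (L1.integrable_coeFn v)
    simp only [VectorFourier.fourierIntegral, LinearMap.neg_apply, neg_neg,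
      LinearMap.flip_apply, innerₗ_apply_apply] at h2
    simp only [SchwartzMap.fourierInv_coe, h_def, Real.Lp.fourierTransformInv_apply,
      Real.fourierInv_eq]
    rw [h2]
    refine integral_congr_ae (ae_of_all _ fun x => ?_)
    simp only [real_inner_comm]
  rw [heq, distLpNorm_coe, ENNReal.coe_one, one_mul, ← ofReal_norm, ← ofReal_norm, Lp.norm_toLp]
  refine ENNReal.ofReal_le_ofReal (ENNReal.toReal_le_of_le_ofReal (norm_nonneg _) ?_)
  rw [eLpNorm_exponent_top]
  exact eLpNormEssSup_le_of_ae_bound (ae_of_all _ hb)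

/-- Symbols of order less than `-N/2` map `L²` to `L^∞`, as they are square integrable. -/
theorem exists_distLpNorm_two_top_le {ι : Type*} {r : ℝ} (hr : 2 * r < -N) (a : ι → Rn N → ℂ)
    (ha : IsSymbol r a) :
    ∃ C : ℝ≥0, ∀ t (T : 𝓢'(Rn N, Cd d)), distLpNorm ∞ (𝓐 (a t) T) ≤ C * distLpNorm 2 T := by
  obtain ⟨C, hC, h⟩ := ha.bound
  have hB := (memLp_bracket_rpow (N := N) hr).const_mul C
  set D : ℝ≥0 := (eLpNorm (fun x : Rn N => C * bracket x ^ r) 2 volume).toNNReal + 1 with hD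
  refine ⟨D, fun t T => ?_⟩
  have hle : eLpNorm (a t) 2 volume ≤ eLpNorm (fun x : Rn N => C * bracket x ^ r) 2 volume :=
    eLpNorm_mono_real (h t)
  have ht := ha.hasTemperateGrowth t
  have hm : MemLp (a t) 2 (volume : Measure (Rn N)) :=
    ⟨ht.1.continuous.aestronglyMeasurable, hle.trans_lt hB.2⟩
  refine (distLpNorm_top_fourierInv_le _).trans ((distLpNorm_one_smulLeftCLM_le (C := D)
    ht hm (by positivity) (hle.trans ?_) _).trans ?_)
  · rw [hD, ENNReal.coe_add, ENNReal.coe_toNNReal hB.2.ne]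
    exact le_self_add
  · gcongr
    exact distLpNorm_fourier_le T

/-- On `L²`, multipliers that are uniformly bounded and converge to zero pointwise converge to zero
strongly. -/
theorem tendsto_distLpNorm_two {a : ℕ → Rn N → ℂ} (ha : ∀ j, (a j).HasTemperateGrowth) {C : ℝ}
    (hC : ∀ j x, ‖a j x‖ ≤ C) (hlim : ∀ x, Tendsto (fun j => a j x) atTop (𝓝 0))
    {T : 𝓢'(Rn N, Cd d)} (hT : distLpNorm 2 T ≠ ∞) :
    Tendsto (fun j => distLpNorm 2 (𝓐 (a j) T)) atTop (𝓝 0) := by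
  have hT' : distLpNorm 2 (𝓕 T) ≠ ∞ := ((distLpNorm_fourier_le T).trans_lt hT.lt_top).ne
  obtain ⟨g, hg⟩ := exists_of_distLpNorm_ne_top hT'
  have hm : ∀ j, MemLp (a j) ∞ (volume : Measure (Rn N)) := fun j =>
    memLp_top_of_bound (ha j).1.continuous.aestronglyMeasurable C (ae_of_all _ (hC j))
  have hle : ∀ j, distLpNorm 2 (𝓐 (a j) T) ≤ eLpNorm (fun x => a j x • g x) 2 volume := by
    intro j
    refine (distLpNorm_fourierInv_le (𝓜 (a j) (𝓕 T))).trans ?_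
    rw [hg, ← Lp.toTemperedDistribution_smul_eq (r := 2) (ha j) (hm j), distLpNorm_coe,
      Lp.enorm_def]
    refine (eLpNorm_congr_ae ?_).le
    filter_upwards [Lp.coeFn_lpSMul (r := 2) ((hm j).toLp _) g, (hm j).coeFn_toLp] with x h1 h2
    rw [h1, Pi.smul_apply', h2]
  refine tendsto_of_tendsto_of_tendsto_of_le_of_le tendsto_const_nhds ?_ (fun _ => zero_le) hle
  have hgm : ∫⁻ x, ‖g x‖ₑ ^ (2 : ℝ) < ∞ := by
    have := (Lp.memLp g).2
    rwa [eLpNorm_lt_top_iff_lintegral_rpow_enorm_lt_top (by norm_num) (by norm_num)] at this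
  have hlint : Tendsto (fun j => ∫⁻ x, ‖a j x • g x‖ₑ ^ (2 : ℝ)) atTop (𝓝 0) := by
    have h0 : ∫⁻ _ : Rn N, (0 : ℝ≥0∞) = 0 := lintegral_zero
    rw [← h0]
    refine tendsto_lintegral_of_dominated_convergence'
      (fun x => ENNReal.ofReal C ^ (2 : ℝ) * ‖g x‖ₑ ^ (2 : ℝ)) (fun j => ?_)
      (fun j => ae_of_all _ fun x => ?_) ?_ (ae_of_all _ fun x => ?_)
    · exact (((ha j).1.continuous.aestronglyMeasurable.smul
        (Lp.aestronglyMeasurable g)).enorm).pow_const _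
    · beta_reduce
      rw [enorm_smul, ENNReal.mul_rpow_of_nonneg _ _ (by norm_num)]
      gcongr
      rw [← ofReal_norm]
      exact ENNReal.ofReal_le_ofReal (hC j x)
    · rw [lintegral_const_mul' _ _ (by finiteness)]
      exact (ENNReal.mul_lt_top (by finiteness) hgm).ne
    · have h1 : Tendsto (fun j => ‖a j x • g x‖ₑ) atTop (𝓝 0) := by
        simpa using ((hlim x).smul_const (g x)).enorm
      simpa using h1.ennrpow_const 2
  have h2 := hlint.ennrpow_const (1 / 2 : ℝ)
  simpa [eLpNorm_eq_lintegral_rpow_enorm_toReal] using h2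

/-- A multiplier with integrable symbol is the convolution with the Fourier transform of the
symbol, so that it is bounded on `L^∞` if the latter is integrable. -/
theorem distLpNorm_top_fourierMultiplierCLM_le {a : Rn N → ℂ} (ha : a.HasTemperateGrowth)
    (hai : Integrable a) (hK : Integrable (𝓕 a)) {C : ℝ≥0} (hC : C ≠ 0)
    (hb : ∫ x, ‖𝓕 a x‖ ≤ C) (T : 𝓢'(Rn N, Cd d)) :
    distLpNorm ∞ (𝓐 a T) ≤ C * distLpNorm ∞ T := by
  refine distLpNorm_map_le hC (fun S => ?_) T
  set K := 𝓕 a with hK_def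
  have hS : ∀ᵐ y, ‖S y‖ ≤ ‖S‖ := by
    have h := ae_le_eLpNormEssSup (f := S) (μ := (volume : Measure (Rn N)))
    filter_upwards [h] with y hy
    rw [← eLpNorm_exponent_top, ← Lp.enorm_def] at hy
    exact enorm_le_iff_norm_le.1 hy
  set h : Rn N → Cd d := fun x => ∫ y, K (y - x) • S y with h_def
  have hKc : Continuous K :=
    VectorFourier.fourierIntegral_continuous Real.continuous_fourierChar
      (innerSL ℝ).continuous₂ hai
  have hjoint : AEStronglyMeasurable (fun q : Rn N × Rn N => K (q.2 - q.1) • S q.2)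
      (volume.prod volume) :=
    (hKc.comp (continuous_snd.sub continuous_fst)).aestronglyMeasurable.smul
      (Lp.aestronglyMeasurable S).comp_snd
  have hhm : AEStronglyMeasurable h volume := hjoint.integral_prod_right'
  have hhb : ∀ x, ‖h x‖ ≤ C * ‖S‖ := fun x => by
    have hi : Integrable (fun y => ‖K (y - x)‖ * ‖S‖) := (hK.comp_sub_right x).norm.mul_const _
    refine (norm_integral_le_of_norm_le hi ?_).trans ?_
    · filter_upwards [hS] with y hy
      rw [norm_smul]
      gcongr
    · rw [integral_mul_const, integral_sub_right_eq_self (fun y => ‖K y‖) x]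
      gcongr
  have hm : MemLp h ∞ (volume : Measure (Rn N)) :=
    memLp_top_of_bound hhm _ (ae_of_all _ hhb)
  have heq : 𝓐 a (S : 𝓢'(Rn N, Cd d)) = (hm.toLp h : 𝓢'(Rn N, Cd d)) := by
    ext1 φ
    rw [TemperedDistribution.fourierMultiplierCLM_apply_apply, Lp.toTemperedDistribution_apply,
      Lp.toTemperedDistribution_apply]
    have h1 : ∫ x, φ x • (hm.toLp h) x = ∫ x, φ x • h x := by
      refine integral_congr_ae ?_
      filter_upwards [hm.coeFn_toLp] with x hx
      rw [hx]
    rw [h1]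
    -- The transposed multiplier, applied to a test function, is a convolution with `K`.
    have hconv : ∀ y, 𝓕 (SchwartzMap.smulLeftCLM ℂ a (𝓕⁻ φ)) y = ∫ x, φ x * K (y - x) := by
      intro y
      have hay : Integrable (fun ξ => 𝐞 (-inner ℝ ξ y) • a ξ) :=
        (Real.fourierIntegral_convergent_iff y).2 hai
      have h2 := VectorFourier.integral_fourierIntegral_smul_eq_flip (L := -innerₗ (Rn N))
        (μ := volume) (ν := volume) Real.continuous_fourierChar
        (by simpa using! continuous_inner.neg) φ.integrable hay
      simp only [VectorFourier.fourierIntegral, LinearMap.neg_apply, neg_neg,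
        LinearMap.flip_apply, innerₗ_apply_apply] at h2
      rw [SchwartzMap.fourier_coe, Real.fourier_eq]
      have h3 : ∀ ξ, 𝐞 (-inner ℝ ξ y) • SchwartzMap.smulLeftCLM ℂ a (𝓕⁻ φ) ξ =
          (∫ v, 𝐞 (inner ℝ v ξ) • φ v) • 𝐞 (-inner ℝ ξ y) • a ξ := fun ξ => by
        rw [SchwartzMap.smulLeftCLM_apply_apply ha, SchwartzMap.fourierInv_coe,
          Real.fourierInv_eq]
        simp only [smul_eq_mul, Circle.smul_def]
        ring
      simp_rw [h3]
      rw [h2]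
      refine integral_congr_ae (ae_of_all _ fun x => ?_)
      simp only [smul_eq_mul]
      congr 1
      rw [hK_def, Real.fourier_eq]
      refine integral_congr_ae (ae_of_all _ fun ξ => ?_)
      simp only [smul_smul, ← AddChar.map_add_eq_mul]
      congr 2
      rw [inner_sub_right, real_inner_comm]
      ring
    simp_rw [hconv]
    have hint : Integrable (fun q : Rn N × Rn N => (φ q.2 * K (q.1 - q.2)) • S q.1)
        (volume.prod volume) := by
      have h4 : Integrable (fun q : Rn N × Rn N => φ q.2 * K (q.1 - q.2))
          (volume.prod volume) :=
        Integrable.convolution_integrand (ContinuousLinearMap.mul ℝ ℂ) φ.integrable hK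
      have hS' : ∀ᵐ q : Rn N × Rn N ∂(volume.prod volume), ‖S q.1‖ ≤ ‖S‖ :=
        Measure.quasiMeasurePreserving_fst.ae hS
      exact h4.smul_bdd ‖S‖ (Lp.aestronglyMeasurable S).comp_fst hS'
    calc ∫ y, (∫ x, φ x * K (y - x)) • S y = ∫ y, ∫ x, (φ x * K (y - x)) • S y := by
          refine integral_congr_ae (ae_of_all _ fun y => ?_)
          simp only [integral_smul_const]
      _ = ∫ x, ∫ y, (φ x * K (y - x)) • S y := integral_integral_swap hint
      _ = ∫ x, φ x • h x := by
          refine integral_congr_ae (ae_of_all _ fun x => ?_)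
          simp only [h_def, mul_smul, integral_smul]
  rw [heq, distLpNorm_coe, ← ofReal_norm, ← ofReal_norm, Lp.norm_toLp]
  refine (ENNReal.ofReal_le_ofReal (ENNReal.toReal_le_of_le_ofReal
    (by positivity : 0 ≤ C * ‖S‖) ?_)).trans ?_
  · rw [eLpNorm_exponent_top]
    exact eLpNormEssSup_le_of_ae_bound (ae_of_all _ hhb)
  · rw [ENNReal.ofReal_mul C.coe_nonneg, ENNReal.ofReal_coe_nnreal]

/-- The Fourier transforms of symbols of order less than `-N` are bounded in `L¹`. -/
theorem exists_integral_fourier_le {ι : Type*} {r : ℝ} (hr : r < -N) (a : ι → Rn N → ℂ)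
    (ha : IsSymbol r a) :
    ∃ C : ℝ, ∀ t, Integrable (𝓕 (a t)) ∧ ∫ x, ‖𝓕 (a t) x‖ ≤ C := by
  have hB := integrable_bracket_rpow (N := N) hr
  have hai : ∀ t l, Integrable (iteratedFDeriv ℝ l (a t)) := fun t l => by
    obtain ⟨C, hC⟩ := (ha l).2 l le_rfl
    refine (hB.const_mul C).mono' ?_ (ae_of_all _ (hC t))
    exact ((ha.contDiff t).continuous_iteratedFDeriv
      (by exact_mod_cast le_top)).aestronglyMeasurable
  have hint : ∀ l, ∃ C : ℝ, ∀ t, ∫ x, ‖iteratedFDeriv ℝ l (a t) x‖ ≤ C := fun l => by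
    obtain ⟨C, hC⟩ := (ha l).2 l le_rfl
    exact ⟨∫ x : Rn N, C * bracket x ^ r, fun t =>
      integral_mono (hai t l).norm (hB.const_mul C) (hC t)⟩
  choose D hD using hint
  have hdecay : ∀ l : ℕ, ∃ C : ℝ, ∀ t w, ‖w‖ ^ l * ‖𝓕 (a t) w‖ ≤ C := fun l => by
    refine ⟨2 ^ l * ∑ p ∈ Finset.range 1 ×ˢ Finset.range (l + 1), D p.2, fun t w => ?_⟩
    have h := Real.pow_mul_norm_iteratedFDeriv_fourier_le (f := a t) (K := 0) (N := ⊤)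
      (ha.contDiff t) (fun k n hk _ => by
        obtain rfl : k = 0 := by simpa using hk
        simpa using (hai t n).norm) (k := 0) (n := l) le_rfl (by simp) w
    simp only [norm_iteratedFDeriv_zero, pow_zero, one_mul, CharP.cast_eq_zero, mul_zero,
      zero_add] at h
    refine h.trans ?_
    gcongr with p hp
    have hp1 : p.1 = 0 := by simpa using (Finset.mem_product.1 hp).1
    simpa [hp1] using hD p.2 t
  obtain ⟨C₁, hC₁⟩ := hdecay 0
  obtain ⟨C₂, hC₂⟩ := hdecay (volume : Measure (Rn N)).integrablePower
  refine ⟨2 ^ (volume : Measure (Rn N)).integrablePower *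
    (∫ x : Rn N, (1 + ‖x‖) ^ (-((volume : Measure (Rn N)).integrablePower : ℝ))) * (C₁ + C₂),
    fun t => ⟨?_, ?_⟩⟩
  · have hc : Continuous (𝓕 (a t)) := VectorFourier.fourierIntegral_continuous
      Real.continuous_fourierChar (innerSL ℝ).continuous₂
      (by simpa [← integrable_norm_iff, (ha.contDiff t).continuous.aestronglyMeasurable]
        using (hai t 0).norm)
    have h := integrable_of_le_of_pow_mul_le (μ := (volume : Measure (Rn N))) (f := 𝓕 (a t))
      (k := 0) (by simpa using hC₁ t) (by simpa using hC₂ t) hc.aestronglyMeasurable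
    simp only [pow_zero, one_mul] at h
    exact (integrable_norm_iff hc.aestronglyMeasurable).1 h
  · have h := integral_pow_mul_le_of_le_of_pow_mul_le (μ := (volume : Measure (Rn N)))
      (f := 𝓕 (a t)) (k := 0) (by simpa using hC₁ t) (by simpa using hC₂ t)
    simpa only [pow_zero, one_mul] using h

/-- Symbols of order less than `-N` are bounded on `L^∞`. -/
theorem exists_distLpNorm_top_le {ι : Type*} {r : ℝ} (hr : r < -N) (a : ι → Rn N → ℂ)
    (ha : IsSymbol r a) :
    ∃ C : ℝ≥0, ∀ t (T : 𝓢'(Rn N, Cd d)), distLpNorm ∞ (𝓐 (a t) T) ≤ C * distLpNorm ∞ T := by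
  obtain ⟨C, hC⟩ := exists_integral_fourier_le hr a ha
  obtain ⟨D, -, hD⟩ := ha.bound
  refine ⟨(|C| + 1).toNNReal, fun t T => ?_⟩
  have hi : Integrable (a t) := ((integrable_bracket_rpow (N := N) hr).const_mul D).mono'
    (ha.contDiff t).continuous.aestronglyMeasurable (ae_of_all _ (hD t))
  refine distLpNorm_top_fourierMultiplierCLM_le (ha.hasTemperateGrowth t) hi (hC t).1 ?_ ?_ T
  · exact (Real.toNNReal_pos.2 (by positivity)).ne'
  · rw [Real.coe_toNNReal _ (by positivity)]
    linarith [(hC t).2, le_abs_self C]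

end BaseBounds

/-! ### Splitting a multiplier into low frequencies and derivatives -/

section Splitting

open scoped NNReal

variable {N d : ℕ}

/-- The symbol `⟨ξ⟩⁻²`, with complex values. -/
def invBracketSq (ξ : Rn N) : ℂ := ((bracketPow 1 (-2) ξ : ℝ) : ℂ)

theorem invBracketSq_mul (ξ : Rn N) : invBracketSq ξ * (1 + ∑ j, coord j ξ * coord j ξ) = 1 := by
  have h0 : (1 + ‖ξ‖ ^ 2 : ℝ) ≠ 0 := by positivity
  have h1 : (1 + ∑ j, coord j ξ * coord j ξ : ℂ) = ((1 + ‖ξ‖ ^ 2 : ℝ) : ℂ) := by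
    rw [EuclideanSpace.norm_sq_eq]
    push_cast
    congr 1
    refine Finset.sum_congr rfl fun i _ => ?_
    rw [coord, Real.norm_eq_abs, ← Complex.ofReal_pow, sq_abs]
    push_cast
    ring
  rw [h1, invBracketSq, bracketPow, one_mul, show (-2 : ℝ) / 2 = -1 by norm_num,
    Real.rpow_neg_one, ← Complex.ofReal_mul, inv_mul_cancel₀ h0, Complex.ofReal_one]

theorem isSymbol_coord {ι : Type*} (j : Fin N) :
    IsSymbol 1 (fun (_ : ι) => (coord j : Rn N → ℂ)) :=
  IsSymbol.linear (Complex.ofRealCLM.comp (EuclideanSpace.proj j : Rn N →L[ℝ] ℝ))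

theorem isSymbol_invBracketSq_pow {ι : Type*} (L : ℕ) :
    IsSymbol (-2 * L) (fun (_ : ι) (ξ : Rn N) => invBracketSq ξ ^ L) := by
  induction L with
  | zero => simpa using IsSymbol.const (N := N) (fun _ : ι => (1 : ℂ)) ⟨1, by simp⟩
  | succ L ih =>
    have h := ih.mul ((isSymbol_bracketPow (N := N) (ι := ι) one_pos (-2)).clm_comp
      Complex.ofRealCLM)
    refine IsSymbol.mono (r := -2 * L + -2) ?_ (by push_cast; linarith)
    simp only [pow_succ]
    exact h

/-- The symbols `ρ_j` of order `-1` with `1 = ⟨ξ⟩^{-2L} + ∑_j ξ_j ρ_j`. -/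
def highSymbol (L : ℕ) (j : Fin N) (ξ : Rn N) : ℂ :=
  coord j ξ * (invBracketSq ξ ^ 1 * ∑ i ∈ Finset.range L, invBracketSq ξ ^ i)

theorem isSymbol_highSymbol {ι : Type*} (L : ℕ) (j : Fin N) :
    IsSymbol (-1) (fun (_ : ι) => (highSymbol L j : Rn N → ℂ)) := by
  have h1 : IsSymbol 0 (fun (_ : ι) (ξ : Rn N) => ∑ i ∈ Finset.range L, invBracketSq ξ ^ i) :=
    IsSymbol.sum fun i _ => (isSymbol_invBracketSq_pow i).mono (by simp)
  have h := (isSymbol_coord (ι := ι) j).mul ((isSymbol_invBracketSq_pow 1).mul h1)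
  exact h.mono (by norm_num)

theorem low_add_high (L : ℕ) (ξ : Rn N) :
    invBracketSq ξ ^ L + ∑ j, coord j ξ * highSymbol L j ξ = 1 := by
  have h1 : ∑ j, coord j ξ * highSymbol L j ξ = (invBracketSq ξ * ∑ j, coord j ξ * coord j ξ) *
      ∑ i ∈ Finset.range L, invBracketSq ξ ^ i := by
    rw [mul_right_comm, Finset.mul_sum]
    exact Finset.sum_congr rfl fun j _ => by rw [highSymbol, pow_one]; ring
  have h2 : invBracketSq ξ * ∑ j, coord j ξ * coord j ξ = 1 - invBracketSq ξ := by
    linear_combination invBracketSq_mul ξ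
  rw [h1, h2, mul_neg_geom_sum]
  ring

theorem fourierMultiplierCLM_add {a b : Rn N → ℂ} (ha : a.HasTemperateGrowth)
    (hb : b.HasTemperateGrowth) (T : 𝓢'(Rn N, Cd d)) :
    𝓐 (fun ξ => a ξ + b ξ) T = 𝓐 a T + 𝓐 b T := by
  have h : 𝓜 (fun ξ => a ξ + b ξ) (𝓕 T) = 𝓜 a (𝓕 T) + 𝓜 b (𝓕 T) := by
    rw [show (fun ξ => a ξ + b ξ) = a + b from rfl,
      TemperedDistribution.smulLeftCLM_add ha hb, _root_.add_apply]
  simp only [TemperedDistribution.fourierMultiplierCLM_apply]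
  rw [h, FourierTransform.fourierInv_add]

theorem lineDeriv_eq (j : Fin N) (T : 𝓢'(Rn N, Cd d)) :
    ∂_{basisVec j} T = (2 * Real.pi * Complex.I) • 𝓐 (coord j) T := by
  rw [coord_eq_inner]
  exact TemperedDistribution.lineDeriv_eq_fourierMultiplierCLM _ _

theorem fourierMultiplierCLM_comm {a b : Rn N → ℂ} (ha : a.HasTemperateGrowth)
    (hb : b.HasTemperateGrowth) (T : 𝓢'(Rn N, Cd d)) : 𝓐 a (𝓐 b T) = 𝓐 b (𝓐 a T) := by
  rw [TemperedDistribution.fourierMultiplierCLM_fourierMultiplierCLM_apply hb ha,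
    TemperedDistribution.fourierMultiplierCLM_fourierMultiplierCLM_apply ha hb, mul_comm]

/-- A multiplier is the sum of a multiplier of very negative order and of multipliers, of order one
less, that act on the first derivatives. -/
theorem fourierMultiplierCLM_split {a : Rn N → ℂ} (ha : a.HasTemperateGrowth) (L : ℕ)
    (T : 𝓢'(Rn N, Cd d)) :
    𝓐 a T = 𝓐 (fun ξ => a ξ * invBracketSq ξ ^ L) T + ∑ j, (2 * Real.pi * Complex.I)⁻¹ •
      𝓐 (fun ξ => a ξ * highSymbol L j ξ) (∂_{basisVec j} T) := by
  have hpi : (2 * Real.pi * Complex.I : ℂ) ≠ 0 := by simp [Real.pi_ne_zero]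
  have hlow := (isSymbol_invBracketSq_pow (N := N) (ι := Unit) L).hasTemperateGrowth ()
  have hhigh := fun j => (isSymbol_highSymbol (N := N) (ι := Unit) L j).hasTemperateGrowth ()
  have hc := hasTemperateGrowth_coord (N := N)
  have h1 : a = fun ξ => a ξ * invBracketSq ξ ^ L
      + ∑ j, (coord j * (fun ξ => a ξ * highSymbol L j ξ) : Rn N → ℂ) ξ := by
    ext ξ
    calc a ξ = a ξ * (invBracketSq ξ ^ L + ∑ j, coord j ξ * highSymbol L j ξ) := by
          rw [low_add_high, mul_one]
      _ = _ := by
          rw [mul_add, Finset.mul_sum]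
          congr 1
          exact Finset.sum_congr rfl fun j _ => by rw [Pi.mul_apply]; ring
  have h2 : ∀ j ∈ (Finset.univ : Finset (Fin N)),
      (coord j * (fun ξ => a ξ * highSymbol L j ξ) : Rn N → ℂ).HasTemperateGrowth := fun j _ =>
    (hc j).mul (ha.mul (hhigh j))
  conv_lhs => rw [h1]
  rw [fourierMultiplierCLM_add (a := fun ξ => a ξ * invBracketSq ξ ^ L) (ha.mul hlow) (.sum h2),
    TemperedDistribution.fourierMultiplierCLM_sum _ h2, _root_.sum_apply]
  congr 1
  refine Finset.sum_congr rfl fun j _ => ?_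
  rw [lineDeriv_eq, map_smul, smul_smul, inv_mul_cancel₀ hpi, one_smul]
  exact (TemperedDistribution.fourierMultiplierCLM_fourierMultiplierCLM_apply (hc j)
    (ha.mul (hhigh j)) T).symm

/-- `D^β` is a Fourier multiplier. -/
theorem exists_multiDeriv_eq (β : Fin N → ℕ) : ∃ g : Rn N → ℂ, g.HasTemperateGrowth ∧
    ∀ T : 𝓢'(Rn N, Cd d), multiDeriv β T = 𝓐 g T := by
  have hone : ∀ (i : Fin N) (b : ℕ), ∃ g : Rn N → ℂ, g.HasTemperateGrowth ∧
      ∀ T : 𝓢'(Rn N, Cd d), (fun z : 𝓢'(Rn N, Cd d) => ∂_{basisVec i} z)^[b] T = 𝓐 g T := by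
    intro i b
    induction b with
    | zero => exact ⟨fun _ => 1, by fun_prop, fun T => by
        rw [TemperedDistribution.fourierMultiplierCLM_const]; exact (one_smul ℂ T).symm⟩
    | succ b ih =>
      obtain ⟨g, hg, h⟩ := ih
      have hc := hasTemperateGrowth_coord (N := N) i
      refine ⟨(2 * Real.pi * Complex.I : ℂ) • (g * coord i), ?_, fun T => ?_⟩
      · exact (Function.HasTemperateGrowth.const (2 * Real.pi * Complex.I : ℂ)).mul (hg.mul hc)
      · rw [Function.iterate_succ_apply', h, lineDeriv_eq,
          TemperedDistribution.fourierMultiplierCLM_smul (hg.mul hc),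
          TemperedDistribution.fourierMultiplierCLM_fourierMultiplierCLM_apply hg hc]
        rfl
  unfold multiDeriv
  induction List.finRange N with
  | nil => exact ⟨fun _ => 1, by fun_prop, fun T => by
      rw [TemperedDistribution.fourierMultiplierCLM_const]; exact (one_smul ℂ T).symm⟩
  | cons i l ih =>
    obtain ⟨g, hg, h⟩ := ih
    obtain ⟨g', hg', h'⟩ := hone i (β i)
    refine ⟨g * g', hg.mul hg', fun T => ?_⟩
    rw [List.foldr_cons, h, h',
      TemperedDistribution.fourierMultiplierCLM_fourierMultiplierCLM_apply hg hg']

theorem fourierMultiplierCLM_multiDeriv {a : Rn N → ℂ} (ha : a.HasTemperateGrowth)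
    (β : Fin N → ℕ) (T : 𝓢'(Rn N, Cd d)) :
    multiDeriv β (𝓐 a T) = 𝓐 a (multiDeriv β T) := by
  obtain ⟨g, hg, h⟩ := exists_multiDeriv_eq (d := d) β
  rw [h, h, fourierMultiplierCLM_comm hg ha]

theorem multiDeriv_sum {κ : Type*} (s : Finset κ) (β : Fin N → ℕ) (T : κ → 𝓢'(Rn N, Cd d)) :
    multiDeriv β (∑ i ∈ s, T i) = ∑ i ∈ s, multiDeriv β (T i) := by
  obtain ⟨g, -, h⟩ := exists_multiDeriv_eq (d := d) β
  simp only [h, map_sum]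

theorem multiDeriv_sub (β : Fin N → ℕ) (S T : 𝓢'(Rn N, Cd d)) :
    multiDeriv β (S - T) = multiDeriv β S - multiDeriv β T := by
  obtain ⟨g, -, h⟩ := exists_multiDeriv_eq (d := d) β
  simp only [h, map_sub]

theorem lineDeriv_comm (i j : Fin N) : Function.Commute
    (fun z : 𝓢'(Rn N, Cd d) => ∂_{basisVec i} z) (fun z => ∂_{basisVec j} z) := fun z => by
  have hc := hasTemperateGrowth_coord (N := N)
  simp only [lineDeriv_eq, map_smul]
  rw [fourierMultiplierCLM_comm (hc i) (hc j)]

/-- One more derivative raises the multi-index; the derivatives of smaller index, which come last in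
`multiDeriv`, have to be commuted with it. -/
theorem lineDeriv_multiDeriv (j : Fin N) (β : Fin N → ℕ) (T : 𝓢'(Rn N, Cd d)) :
    ∂_{basisVec j} (multiDeriv β T) = multiDeriv (β + Pi.single j 1) T := by
  have key : ∀ l : List (Fin N), l.Nodup →
      l.foldr (fun i w => (fun z : 𝓢'(Rn N, Cd d) =>
          ∂_{basisVec i} z)^[(β + Pi.single j 1 : Fin N → ℕ) i] w) T =
        if j ∈ l then ∂_{basisVec j} (l.foldr (fun i w => (fun z : 𝓢'(Rn N, Cd d) =>
          ∂_{basisVec i} z)^[β i] w) T)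
        else l.foldr (fun i w => (fun z : 𝓢'(Rn N, Cd d) => ∂_{basisVec i} z)^[β i] w) T := by
    intro l hl
    induction l with
    | nil => simp
    | cons i l ih =>
      rw [List.nodup_cons] at hl
      rw [List.foldr_cons, List.foldr_cons, ih hl.2]
      rcases eq_or_ne i j with rfl | hij
      · rw [if_neg hl.1, if_pos (by simp)]
        simp only [Pi.add_apply, Pi.single_eq_same]
        rw [Function.iterate_succ_apply']
      · have h1 : (β + Pi.single j 1 : Fin N → ℕ) i = β i := by
          simp [hij]
        simp only [h1, List.mem_cons, hij.symm, false_or]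
        split_ifs
        · exact (lineDeriv_comm i j).iterate_left (β i) _
        · rfl
  have h := key (List.finRange N) (List.nodup_finRange N)
  rw [if_pos (List.mem_finRange j)] at h
  exact h.symm

end Splitting

/-! ### Multipliers on the space -/

section SpaceBounds

open scoped NNReal

variable {N d k m n : ℕ}

theorem mem_multiIndices {j : ℕ} {β : Fin N → ℕ} : β ∈ multiIndices N j ↔ ∑ i, β i = j := by
  simp [multiIndices, Finset.mem_piAntidiag]

theorem weightedNorm_top_le_spaceNorm {β : Fin N → ℕ} (hβ : ∑ i, β i ≤ 2 * m - 2) (u : L2 N d) :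
    weightedNorm n ∞ β u ≤ spaceNorm k m n u := by
  refine le_trans ?_ le_self_add
  refine le_trans ?_ (Finset.single_le_sum (f := fun j => ∑ β ∈ multiIndices N j,
    weightedNorm n ∞ β u) (fun _ _ => zero_le) (Finset.mem_Icc.2 ⟨Nat.zero_le _, hβ⟩))
  exact Finset.single_le_sum (f := fun β => weightedNorm n ∞ β u) (fun _ _ => zero_le)
    (mem_multiIndices.2 rfl)

theorem weightedNorm_two_le_spaceNorm {β : Fin N → ℕ} (hβ : 2 * m - 1 ≤ ∑ i, β i)
    (hβ' : ∑ i, β i ≤ order k m) (u : L2 N d) :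
    weightedNorm n 2 β u ≤ spaceNorm k m n u := by
  refine le_trans ?_ le_add_self
  refine le_trans ?_ (Finset.single_le_sum (f := fun j => ∑ β ∈ multiIndices N j,
    weightedNorm n 2 β u) (fun _ _ => zero_le) (Finset.mem_Icc.2 ⟨hβ, hβ'⟩))
  exact Finset.single_le_sum (f := fun β => weightedNorm n 2 β u) (fun _ _ => zero_le)
    (mem_multiIndices.2 rfl)

theorem spaceNorm_lt_top {u : L2 N d} (hu : u ∈ space N d k m n) : spaceNorm k m n u < ∞ := by
  refine ENNReal.add_lt_top.2 ⟨ENNReal.sum_lt_top.2 fun j hj => ENNReal.sum_lt_top.2 fun β hβ => ?_,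
    ENNReal.sum_lt_top.2 fun j hj => ENNReal.sum_lt_top.2 fun β hβ => ?_⟩
  · rw [mem_multiIndices] at hβ
    exact hu.2.1 β (hβ ▸ (Finset.mem_Icc.1 hj).2)
  · rw [mem_multiIndices] at hβ
    exact hu.2.2 β (hβ ▸ (Finset.mem_Icc.1 hj).1) (hβ ▸ (Finset.mem_Icc.1 hj).2)

theorem sum_add_single (β : Fin N → ℕ) (j : Fin N) :
    ∑ i, (β + Pi.single j 1 : Fin N → ℕ) i = ∑ i, β i + 1 := by
  simp [Finset.sum_add_distrib]

/-- Weighted Sobolev embedding with multipliers: for symbols `a` of order `r ≤ J - |β| - k`, where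
`k > N/2`, the weighted sup norm of `a(D) D^β u` is bounded by the norm of `u`.

By downward induction on `|β|`, low frequencies are estimated by the part of the norm that controls
`D^β u`, and high frequencies are turned into one more derivative. -/
theorem exists_wNorm_top_le (hk : (N : ℝ) / 2 < k) {ι : Type*} (e : ℕ) {r : ℝ}
    (a : ι → Rn N → ℂ) (ha : IsSymbol r a) (hr : r ≤ e - k) (β : Fin N → ℕ)
    (hβ : ∑ i, β i + e = order k m) :
    ∃ C : ℝ≥0, ∀ t (u : L2 N d),
      wNorm n ∞ (𝓐 (a t) (multiDeriv β (u : 𝓢'(Rn N, Cd d)))) ≤ C * spaceNorm k m n u := by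
  induction e generalizing r a β with
  | zero =>
    have hr' : 2 * r < -N := by
      push_cast at hr
      linarith
    obtain ⟨C, hC⟩ := exists_wNorm_fourierMultiplierCLM_le (d := d)
      (exists_distLpNorm_two_top_le hr') n a ha
    refine ⟨C, fun t u => (hC t _).trans ?_⟩
    gcongr
    exact weightedNorm_two_le_spaceNorm (by unfold order at hβ; omega) hβ.le u
  | succ e ih =>
    -- With `L > r + N` the low frequency symbol has order `r - 2L < -N`, enough for both the
    -- `L^∞ → L^∞` and the `L² → L^∞` bound.
    obtain ⟨L, hL⟩ := exists_nat_gt (r + N)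
    have hN : (0 : ℝ) ≤ N := N.cast_nonneg
    have hL0 : (0 : ℝ) ≤ L := L.cast_nonneg
    have hlow : IsSymbol (r + -2 * L) (fun t ξ => a t ξ * invBracketSq ξ ^ L) :=
      ha.mul (isSymbol_invBracketSq_pow L)
    have hhigh : ∀ j, IsSymbol (r + -1) (fun t ξ => a t ξ * highSymbol L j ξ) := fun j =>
      ha.mul (isSymbol_highSymbol L j)
    have h1 : ∃ C : ℝ≥0, ∀ t (u : L2 N d),
        wNorm n ∞ (𝓐 (fun ξ => a t ξ * invBracketSq ξ ^ L)
          (multiDeriv β (u : 𝓢'(Rn N, Cd d)))) ≤ C * spaceNorm k m n u := by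
      rcases le_or_gt (∑ i, β i) (2 * m - 2) with h | h
      · obtain ⟨C, hC⟩ := exists_wNorm_fourierMultiplierCLM_le (d := d)
          (exists_distLpNorm_top_le (show r + -2 * L < -N by linarith)) n _ hlow
        refine ⟨C, fun t u => (hC t _).trans ?_⟩
        gcongr
        exact weightedNorm_top_le_spaceNorm h u
      · obtain ⟨C, hC⟩ := exists_wNorm_fourierMultiplierCLM_le (d := d)
          (exists_distLpNorm_two_top_le (show 2 * (r + -2 * L) < -N by linarith)) n _ hlow
        refine ⟨C, fun t u => (hC t _).trans ?_⟩
        gcongr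
        exact weightedNorm_two_le_spaceNorm (by omega) (by omega) u
    obtain ⟨C, hC⟩ := h1
    choose D hD using fun j => ih _ (hhigh j) (by push_cast at hr; linarith)
      (β + Pi.single j 1) (by rw [sum_add_single]; omega)
    refine ⟨C + ∑ j, ‖(2 * Real.pi * Complex.I : ℂ)⁻¹‖₊ * D j, fun t u => ?_⟩
    rw [fourierMultiplierCLM_split (ha.hasTemperateGrowth t) L]
    push_cast
    rw [add_mul, Finset.sum_mul]
    refine (wNorm_add_le n _ _).trans (add_le_add (hC t u) ((wNorm_sum_le n _ _).trans
      (Finset.sum_le_sum fun j _ => (wNorm_smul_le n _ _).trans ?_)))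
    rw [lineDeriv_multiDeriv]
    refine (mul_le_mul_right (hD j t u) _).trans_eq ?_
    rw [← mul_assoc]
    rfl

end SpaceBounds

/-! ### Strong continuity in weighted `L²` -/

section StrongContinuity

variable {N d : ℕ}

/-- Symbols `a_j = δ_j b_j`, bounded of order `0`, with `b_j` bounded of order `1` and `δ_j → 0`,
converge to zero strongly on weighted `L²`: the condition passes to derivatives of the symbols. -/
theorem tendsto_wNorm_two (n : ℕ) {δ : ℕ → ℝ} (hδ : Tendsto δ atTop (𝓝 0)) {a b : ℕ → Rn N → ℂ}
    (ha : IsSymbol 0 a) (hb : IsSymbol 1 b) (hab : ∀ j ξ, a j ξ = δ j * b j ξ)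
    {T : 𝓢'(Rn N, Cd d)} (hT : wNorm n 2 T ≠ ∞) :
    Tendsto (fun j => wNorm n 2 (𝓐 (a j) T)) atTop (𝓝 0) := by
  induction n generalizing a b T with
  | zero =>
    simp only [wNorm_zero_weight] at hT ⊢
    obtain ⟨C, -, hC⟩ := ha.bound
    obtain ⟨D, -, hD⟩ := hb.bound
    refine tendsto_distLpNorm_two ha.hasTemperateGrowth (C := C)
      (fun j x => by simpa using hC j x) (fun x => ?_) hT
    have h1 : Tendsto (fun j => |δ j| * (D * bracket x ^ (1 : ℝ))) atTop (𝓝 0) := by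
      simpa using hδ.abs.mul_const (D * bracket x ^ (1 : ℝ))
    refine squeeze_zero_norm (fun j => ?_) h1
    rw [hab, norm_mul, Complex.norm_real, Real.norm_eq_abs]
    gcongr
    exact hD j x
  | succ n ih =>
    have hle : ∀ j, wNorm (n + 1) 2 (𝓐 (a j) T) ≤ wNorm n 2 (𝓐 (a j) T) +
        ∑ i, (wNorm n 2 (𝓐 (a j) (TemperedDistribution.smulLeftCLM (Cd d) (coord i) T)) +
          wNorm n 2 (𝓐 (fun ξ => fderiv ℝ (a j) ξ (basisVec i)) T)) := fun j =>
      (wNorm_succ_le n _).trans (add_le_add le_rfl (Finset.sum_le_sum fun i _ =>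
        wNorm_coord_fourierMultiplierCLM_le n (ha.hasTemperateGrowth j) i T))
    have hT0 : wNorm n 2 T ≠ ∞ := ne_top_of_le_ne_top hT (wNorm_le_succ n T)
    refine tendsto_of_tendsto_of_tendsto_of_le_of_le tendsto_const_nhds ?_
      (fun _ => zero_le) hle
    have h1 := ih ha hb hab hT0
    have h2 := fun i : Fin N => ih ha hb hab (ne_top_of_le_ne_top hT (wNorm_coord_le n i T))
    have h3 := fun i : Fin N => ih (ha.fderiv_apply (basisVec i)) (hb.fderiv_apply (basisVec i))
      (fun j ξ => by
        have h : a j = fun ξ => (δ j : ℂ) * b j ξ := funext (hab j)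
        rw [h, fderiv_const_mul ((hb.contDiff j).differentiable (by simp) ξ)]
        simp) hT0
    simpa using h1.add (tendsto_finsetSum Finset.univ fun i _ => (h2 i).add (h3 i))

end StrongContinuity

/-! ### The group on distributions -/

section Group

open scoped NNReal

variable {N d k m n : ℕ}

/-- The action of a linear map of `ℂ^d` on the values of a distribution. -/
def mapValues (A : Cd d →L[ℂ] Cd d) : 𝓢'(Rn N, Cd d) →L[ℂ] 𝓢'(Rn N, Cd d) :=
  PointwiseConvergenceCLM.postcomp 𝓢(Rn N, ℂ) A

theorem mapValues_coe (A : Cd d →L[ℂ] Cd d) {p : ℝ≥0∞} [Fact (1 ≤ p)]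
    (f : Lp (Cd d) p (volume : Measure (Rn N))) :
    mapValues A (f : 𝓢'(Rn N, Cd d)) = (A.compLp f : 𝓢'(Rn N, Cd d)) := by
  ext1 φ
  have h : mapValues A (f : 𝓢'(Rn N, Cd d)) φ = A ((f : 𝓢'(Rn N, Cd d)) φ) := rfl
  have hint : Integrable (fun x => φ x • f x) := by
    have hq := ENNReal.HolderConjugate.inv_one_sub_inv' (Fact.out : 1 ≤ p)
    exact memLp_one_iff_integrable.1
      ((Lp.memLp f).smul (φ.memLp (1 - p⁻¹)⁻¹ volume) (hpqr := hq.symm))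
  rw [h, Lp.toTemperedDistribution_apply, Lp.toTemperedDistribution_apply,
    ← A.integral_comp_comm hint]
  refine integral_congr_ae ?_
  filter_upwards [A.coeFn_compLp f] with x hx
  rw [hx, map_smul]

theorem distLpNorm_mapValues_le {A : Cd d →L[ℂ] Cd d} (hA : ‖A‖ ≤ 1) {p : ℝ≥0∞} [Fact (1 ≤ p)]
    (T : 𝓢'(Rn N, Cd d)) : distLpNorm p (mapValues A T) ≤ distLpNorm p T := by
  refine (distLpNorm_map_le (p := p) (A := fun T => mapValues A T) (C := 1) one_ne_zero
    (fun f => ?_) T).trans (by rw [ENNReal.coe_one, one_mul])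
  rw [mapValues_coe, distLpNorm_coe, ENNReal.coe_one, one_mul, ← ofReal_norm, ← ofReal_norm]
  refine ENNReal.ofReal_le_ofReal ((A.norm_compLp_le f).trans ?_)
  exact mul_le_of_le_one_left (norm_nonneg _) hA

theorem multiDeriv_mapValues (A : Cd d →L[ℂ] Cd d) (β : Fin N → ℕ) (T : 𝓢'(Rn N, Cd d)) :
    multiDeriv β (mapValues A T) = mapValues A (multiDeriv β T) := by
  obtain ⟨g, -, h⟩ := exists_multiDeriv_eq (d := d) β
  rw [h, h]
  rfl

theorem weightedNorm_compLp_le {A : Cd d →L[ℂ] Cd d} (hA : ‖A‖ ≤ 1) {p : ℝ≥0∞} [Fact (1 ≤ p)]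
    (β : Fin N → ℕ) (u : L2 N d) :
    weightedNorm n p β (A.compLp u) ≤ weightedNorm n p β u := by
  rw [weightedNorm_eq, ← mapValues_coe, multiDeriv_mapValues]
  exact distLpNorm_mapValues_le hA (𝓜 (weight n) (multiDeriv β (u : 𝓢'(Rn N, Cd d))))

theorem spaceNorm_compLp_le {A : Cd d →L[ℂ] Cd d} (hA : ‖A‖ ≤ 1) (u : L2 N d) :
    spaceNorm k m n (A.compLp u) ≤ spaceNorm k m n u :=
  add_le_add
    (Finset.sum_le_sum fun _ _ => Finset.sum_le_sum fun β _ => weightedNorm_compLp_le hA β u)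
    (Finset.sum_le_sum fun _ _ => Finset.sum_le_sum fun β _ => weightedNorm_compLp_le hA β u)

/-- The projection of `ℂ²` onto the `i`-th coordinate axis, an eigenspace of `γ`. -/
def axisProj (i : Fin 2) : Cd 2 →L[ℂ] Cd 2 :=
  (EuclideanSpace.proj i : Cd 2 →L[ℂ] ℂ).smulRight (EuclideanSpace.single i (1 : ℂ))

theorem axisProj_apply (i : Fin 2) (z : Cd 2) :
    axisProj i z = z i • EuclideanSpace.single i (1 : ℂ) := rfl

theorem norm_axisProj_le (i : Fin 2) : ‖axisProj i‖ ≤ 1 := by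
  refine ContinuousLinearMap.opNorm_le_bound _ zero_le_one fun z => ?_
  rw [axisProj_apply, norm_smul, one_mul]
  simpa using PiLp.norm_apply_le z i

/-- The sign with which the time enters the propagator on the `i`-th axis. -/
def axisSign : Fin 2 → ℝ := ![-1, 1]

theorem abs_axisSign (i : Fin 2) : |axisSign i| = 1 := by
  fin_cases i <;> simp [axisSign]

theorem symbolAct_eq (t : ℝ) (ξ : Rn N) (z : Cd 2) :
    symbolAct t ξ z = ∑ i, propagator (axisSign i * t) ξ • axisProj i z := by
  ext j
  simp only [symbolAct, symbol_eq, Matrix.mulVec_diagonal, Fin.sum_univ_two, axisProj_apply,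
    axisSign, propagator, dispersion]
  fin_cases j <;> simp

theorem hasTemperateGrowth_propagator (t : ℝ) :
    (propagator t : Rn N → ℂ).HasTemperateGrowth :=
  (isSymbol_propagator (τ := fun _ : Unit => t) (T := |t|) fun _ => le_rfl).hasTemperateGrowth ()

/-- The group acts by a scalar propagator on each eigenspace of `γ`. -/
theorem group_coe (t : ℝ) (u : L2 N 2) : (group t u : 𝓢'(Rn N, Cd 2)) =
    ∑ i, 𝓐 (propagator (axisSign i * t)) ((axisProj i).compLp u : 𝓢'(Rn N, Cd 2)) := by
  have hm : ∀ i : Fin 2, MemLp (propagator (axisSign i * t)) ∞ (volume : Measure (Rn N)) :=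
    fun i => memLp_top_of_bound (contDiff_propagator _).continuous.aestronglyMeasurable 1
      (ae_of_all _ fun ξ => (norm_propagator _ ξ).le)
  have h1 : (memLp_symbolAct t (𝓕 u)).toLp (fun ξ => symbolAct t ξ ((𝓕 u : L2 N 2) ξ)) =
      ∑ i, ((hm i).toLp _ • (axisProj i).compLp (𝓕 u) : L2 N 2) := by
    rw [Fin.sum_univ_two]
    refine Lp.ext ?_
    filter_upwards [(memLp_symbolAct t (𝓕 u)).coeFn_toLp,
      Lp.coeFn_add ((hm 0).toLp _ • (axisProj 0).compLp (𝓕 u) : L2 N 2)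
        ((hm 1).toLp _ • (axisProj 1).compLp (𝓕 u) : L2 N 2),
      Lp.coeFn_lpSMul (r := 2) ((hm 0).toLp _) ((axisProj 0).compLp (𝓕 u)),
      Lp.coeFn_lpSMul (r := 2) ((hm 1).toLp _) ((axisProj 1).compLp (𝓕 u)),
      (hm 0).coeFn_toLp, (hm 1).coeFn_toLp, (axisProj 0).coeFn_compLp (𝓕 u),
      (axisProj 1).coeFn_compLp (𝓕 u)] with ξ e1 e2 e3 e4 e5 e6 e7 e8
    rw [e1, e2, Pi.add_apply, e3, e4, Pi.smul_apply', Pi.smul_apply', e5, e6, e7, e8,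
      symbolAct_eq, Fin.sum_univ_two]
  have h2 : ((∑ i, ((hm i).toLp _ • (axisProj i).compLp (𝓕 u) : L2 N 2) : L2 N 2) :
      𝓢'(Rn N, Cd 2)) = ∑ i, 𝓜 (propagator (axisSign i * t))
        (mapValues (axisProj i) (𝓕 (u : 𝓢'(Rn N, Cd 2)))) := by
    have h := map_sum (Lp.toTemperedDistributionCLM (Cd 2) (volume : Measure (Rn N)) 2)
      (fun i => ((hm i).toLp _ • (axisProj i).compLp (𝓕 u) : L2 N 2)) Finset.univ
    refine h.trans (Finset.sum_congr rfl fun i _ => ?_)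
    rw [Lp.toTemperedDistributionCLM_apply,
      Lp.toTemperedDistribution_smul_eq (hasTemperateGrowth_propagator _) (hm i),
      Lp.fourier_toTemperedDistribution_eq, mapValues_coe]
  rw [group, ← Lp.fourierInv_toTemperedDistribution_eq, h1, h2, FourierTransform.fourierInv_sum]
  refine Finset.sum_congr rfl fun i _ => ?_
  rw [← mapValues_coe, TemperedDistribution.fourierMultiplierCLM_apply]
  rfl

theorem group_zero (u : L2 N 2) : group 0 u = u := by
  have h : (memLp_symbolAct 0 (𝓕 u)).toLp (fun ξ => symbolAct 0 ξ ((𝓕 u : L2 N 2) ξ)) = 𝓕 u := by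
    refine Lp.ext ?_
    filter_upwards [(memLp_symbolAct 0 (𝓕 u)).coeFn_toLp] with ξ hξ
    rw [hξ]
    ext j
    fin_cases j <;> simp [symbolAct, symbol_eq]
  rw [group, h, fourierInv_fourier_eq]

theorem multiDeriv_group (β : Fin N → ℕ) (t : ℝ) (u : L2 N 2) :
    multiDeriv β (group t u : 𝓢'(Rn N, Cd 2)) = ∑ i, 𝓐 (propagator (axisSign i * t))
      (multiDeriv β ((axisProj i).compLp u : 𝓢'(Rn N, Cd 2))) := by
  rw [group_coe, multiDeriv_sum]
  exact Finset.sum_congr rfl fun i _ =>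
    fourierMultiplierCLM_multiDeriv (hasTemperateGrowth_propagator _) β _

theorem multiDeriv_group_sub (β : Fin N → ℕ) (t s : ℝ) (u : L2 N 2) :
    multiDeriv β ((group t u - group s u : L2 N 2) : 𝓢'(Rn N, Cd 2)) =
      ∑ i, 𝓐 (fun ξ => propagator (axisSign i * t) ξ - propagator (axisSign i * s) ξ)
        (multiDeriv β ((axisProj i).compLp u : 𝓢'(Rn N, Cd 2))) := by
  have h : ((group t u - group s u : L2 N 2) : 𝓢'(Rn N, Cd 2)) =
      (group t u : 𝓢'(Rn N, Cd 2)) - (group s u : 𝓢'(Rn N, Cd 2)) :=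
    map_sub (Lp.toTemperedDistributionCLM (Cd 2) (volume : Measure (Rn N)) 2) _ _
  rw [h, multiDeriv_sub, multiDeriv_group, multiDeriv_group, ← Finset.sum_sub_distrib]
  refine Finset.sum_congr rfl fun i _ => ?_
  have h1 := hasTemperateGrowth_propagator (N := N) (axisSign i * t)
  have h2 := hasTemperateGrowth_propagator (N := N) (axisSign i * s)
  rw [sub_eq_iff_eq_add, ← fourierMultiplierCLM_add
    (a := fun ξ => propagator (axisSign i * t) ξ - propagator (axisSign i * s) ξ) (h1.sub h2) h2]
  simp

theorem abs_axisSign_mul_le (i : Fin 2) {t T : ℝ} (ht : |t| ≤ T) : |axisSign i * t| ≤ T := by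
  rwa [abs_mul, abs_axisSign, one_mul]

/-! ### Estimates for the group -/

theorem exists_weightedNorm_top_group_le (hk : (N : ℝ) / 2 < k) (T : ℝ) (β : Fin N → ℕ)
    (hβ : ∑ i, β i ≤ 2 * m) : ∃ C : ℝ≥0, ∀ t : ℝ, |t| ≤ T → ∀ u : L2 N 2,
      weightedNorm n ∞ β (group t u) ≤ C * spaceNorm k m n u := by
  obtain ⟨e, he⟩ := Nat.exists_eq_add_of_le (show ∑ i, β i ≤ order k m by unfold order; omega)
  have hek : k ≤ e := by unfold order at he; omega
  have hek' : (0 : ℝ) ≤ e - k := by simpa using hek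
  choose C hC using fun i : Fin 2 => exists_wNorm_top_le (d := 2) (n := n) (m := m) hk e
    (fun t : {t : ℝ // |t| ≤ T} => propagator (axisSign i * t))
    (isSymbol_propagator fun t => abs_axisSign_mul_le i t.2) hek' β he.symm
  refine ⟨∑ i, C i, fun t ht u => ?_⟩
  rw [weightedNorm_eq, multiDeriv_group]
  push_cast
  rw [Finset.sum_mul]
  refine (wNorm_sum_le n _ _).trans (Finset.sum_le_sum fun i _ => (hC i ⟨t, ht⟩ _).trans ?_)
  gcongr
  exact spaceNorm_compLp_le (norm_axisProj_le i) u

theorem exists_weightedNorm_two_group_le (T : ℝ) (β : Fin N → ℕ)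
    (hβ : 2 * m - 1 ≤ ∑ i, β i) (hβ' : ∑ i, β i ≤ order k m) :
    ∃ C : ℝ≥0, ∀ t : ℝ, |t| ≤ T → ∀ u : L2 N 2,
      weightedNorm n 2 β (group t u) ≤ C * spaceNorm k m n u := by
  choose C hC using fun i : Fin 2 => exists_wNorm_fourierMultiplierCLM_le (d := 2)
    exists_distLpNorm_two_le n
    (fun t : {t : ℝ // |t| ≤ T} => (propagator (axisSign i * t) : Rn N → ℂ))
    (isSymbol_propagator fun t => abs_axisSign_mul_le i t.2)
  refine ⟨∑ i, C i, fun t ht u => ?_⟩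
  rw [weightedNorm_eq, multiDeriv_group]
  push_cast
  rw [Finset.sum_mul]
  refine (wNorm_sum_le n _ _).trans (Finset.sum_le_sum fun i _ => (hC i ⟨t, ht⟩ _).trans ?_)
  gcongr
  exact (weightedNorm_two_le_spaceNorm hβ hβ' _).trans
    (spaceNorm_compLp_le (norm_axisProj_le i) u)

/-- The group is Lipschitz in time for the weighted sup norms of the derivatives of order at most
`2m`, because the difference quotients of the propagator are symbols of order `1`. -/
theorem exists_weightedNorm_top_group_sub_le (hk : (N : ℝ) / 2 < k) (T : ℝ) (β : Fin N → ℕ)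
    (hβ : ∑ i, β i ≤ 2 * m) : ∃ C : ℝ≥0, ∀ t s : ℝ, |t| ≤ T → |s| ≤ T → ∀ u : L2 N 2,
      weightedNorm n ∞ β (group t u - group s u)
        ≤ C * ENNReal.ofReal |t - s| * spaceNorm k m n u := by
  -- The loss of one derivative is covered, as `J - |β| - k ≥ 2` for `|β| ≤ 2m`.
  obtain ⟨e, he⟩ := Nat.exists_eq_add_of_le (show ∑ i, β i ≤ order k m by unfold order; omega)
  have hek : 1 + k ≤ e := by unfold order at he; omega
  have hek' : (1 : ℝ) ≤ e - k := by
    have : (1 : ℝ) + k ≤ e := by exact_mod_cast hek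
    linarith
  have hsym := fun i : Fin 2 => isSymbol_propagatorSlope (N := N) (T := T)
    (τ := fun q : {q : ℝ × ℝ // |q.1| ≤ T ∧ |q.2| ≤ T} => axisSign i * q.1.1)
    (σ := fun q => axisSign i * q.1.2) (fun q => abs_axisSign_mul_le i q.2.1)
    (fun q => abs_axisSign_mul_le i q.2.2)
  choose C hC using fun i : Fin 2 => exists_wNorm_top_le (d := 2) (n := n) (m := m) hk e
    _ (hsym i) hek' β he.symm
  refine ⟨∑ i, C i, fun t s ht hs u => ?_⟩
  rw [weightedNorm_eq, multiDeriv_group_sub]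
  push_cast
  rw [Finset.sum_mul, Finset.sum_mul]
  refine (wNorm_sum_le n _ _).trans (Finset.sum_le_sum fun i _ => ?_)
  have h1 : (fun ξ : Rn N => propagator (axisSign i * t) ξ - propagator (axisSign i * s) ξ) =
      ((axisSign i * t - axisSign i * s : ℝ) : ℂ) •
        propagatorSlope (axisSign i * t) (axisSign i * s) := by
    ext ξ
    exact (propagatorSlope_mul _ _ ξ).symm
  rw [h1, TemperedDistribution.fourierMultiplierCLM_smul
    ((hsym i).hasTemperateGrowth ⟨(t, s), ht, hs⟩)]
  refine (wNorm_smul_le n _ _).trans ?_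
  have h2 : ‖((axisSign i * t - axisSign i * s : ℝ) : ℂ)‖ₑ = ENNReal.ofReal |t - s| := by
    rw [← ofReal_norm, Complex.norm_real, Real.norm_eq_abs, ← mul_sub, abs_mul, abs_axisSign,
      one_mul]
  rw [h2, mul_right_comm, mul_comm]
  gcongr
  refine (hC i ⟨(t, s), ht, hs⟩ _).trans ?_
  gcongr
  exact spaceNorm_compLp_le (norm_axisProj_le i) u

theorem tendsto_weightedNorm_two_group_sub (β : Fin N → ℕ) (u : L2 N 2)
    (hu : weightedNorm n 2 β u ≠ ∞) (s : ℝ) :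
    Tendsto (fun t => weightedNorm n 2 β (group t u - group s u)) (𝓝 s) (𝓝 0) := by
  refine tendsto_of_seq_tendsto fun τ hτ => ?_
  obtain ⟨T, hT⟩ : ∃ T, ∀ j, |τ j| ≤ T := by
    obtain ⟨T, hT⟩ := (Metric.isBounded_range_of_tendsto τ hτ).exists_norm_le
    exact ⟨T, fun j => hT _ ⟨j, rfl⟩⟩
  have hle : ∀ j, weightedNorm n 2 β (group (τ j) u - group s u) ≤
      ∑ i, wNorm n 2 (𝓐 (fun ξ => propagator (axisSign i * τ j) ξ - propagator (axisSign i * s) ξ)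
        (multiDeriv β ((axisProj i).compLp u : 𝓢'(Rn N, Cd 2)))) := fun j => by
    rw [weightedNorm_eq, multiDeriv_group_sub]
    exact wNorm_sum_le n _ _
  refine tendsto_of_tendsto_of_tendsto_of_le_of_le tendsto_const_nhds ?_ (fun _ => zero_le) hle
  rw [show (0 : ℝ≥0∞) = ∑ _i : Fin 2, 0 by simp]
  refine tendsto_finsetSum _ fun i _ => ?_
  have hτ' : ∀ j, |axisSign i * τ j| ≤ max T |s| := fun j =>
    abs_axisSign_mul_le i ((hT j).trans (le_max_left _ _))
  have hs' : ∀ _ : ℕ, |axisSign i * s| ≤ max T |s| := fun _ =>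
    abs_axisSign_mul_le i (le_max_right _ _)
  have hδ : Tendsto (fun j => axisSign i * τ j - axisSign i * s) atTop (𝓝 0) := by
    simpa using (hτ.const_mul (axisSign i)).sub_const (axisSign i * s)
  have hsub : IsSymbol 0 (fun j (ξ : Rn N) =>
      propagator (axisSign i * τ j) ξ - propagator (axisSign i * s) ξ) := by
    simpa [sub_eq_add_neg] using (isSymbol_propagator hτ').add ((isSymbol_propagator hs').clm_comp
      (-ContinuousLinearMap.id ℝ ℂ))
  refine tendsto_wNorm_two n hδ hsub (isSymbol_propagatorSlope hτ' hs')
    (fun j ξ => (propagatorSlope_mul _ _ ξ).symm) ?_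
  exact ne_top_of_le_ne_top hu (weightedNorm_compLp_le (norm_axisProj_le i) β u)

theorem exists_spaceNorm_group_le (hk : (N : ℝ) / 2 < k) (T : ℝ) :
    ∃ C : ℝ≥0, ∀ t : ℝ, |t| ≤ T → ∀ u : L2 N 2,
      spaceNorm k m n (group t u) ≤ C * spaceNorm k m n u := by
  have h1 : ∀ β : Fin N → ℕ, ∃ C : ℝ≥0, ∑ i, β i ≤ 2 * m → ∀ t : ℝ, |t| ≤ T → ∀ u : L2 N 2,
      weightedNorm n ∞ β (group t u) ≤ C * spaceNorm k m n u := fun β => by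
    by_cases hβ : ∑ i, β i ≤ 2 * m
    · obtain ⟨C, hC⟩ := exists_weightedNorm_top_group_le (n := n) (m := m) hk T β hβ
      exact ⟨C, fun _ => hC⟩
    · exact ⟨0, fun h => absurd h hβ⟩
  have h2 : ∀ β : Fin N → ℕ, ∃ C : ℝ≥0, 2 * m - 1 ≤ ∑ i, β i ∧ ∑ i, β i ≤ order k m →
      ∀ t : ℝ, |t| ≤ T → ∀ u : L2 N 2,
      weightedNorm n 2 β (group t u) ≤ C * spaceNorm k m n u := fun β => by
    by_cases hβ : 2 * m - 1 ≤ ∑ i, β i ∧ ∑ i, β i ≤ order k m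
    · obtain ⟨C, hC⟩ := exists_weightedNorm_two_group_le (n := n) T β hβ.1 hβ.2
      exact ⟨C, fun _ => hC⟩
    · exact ⟨0, fun h => absurd h hβ⟩
  choose C hC using h1
  choose D hD using h2
  refine ⟨(∑ j ∈ Finset.Icc 0 (2 * m - 2), ∑ β ∈ multiIndices N j, C β)
    + ∑ j ∈ Finset.Icc (2 * m - 1) (order k m), ∑ β ∈ multiIndices N j, D β, fun t ht u => ?_⟩
  push_cast
  simp only [add_mul, Finset.sum_mul]
  refine add_le_add (Finset.sum_le_sum fun j hj => Finset.sum_le_sum fun β hβ => ?_)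
    (Finset.sum_le_sum fun j hj => Finset.sum_le_sum fun β hβ => ?_)
  · rw [mem_multiIndices] at hβ
    exact hC β (by have := (Finset.mem_Icc.1 hj).2; omega) t ht u
  · rw [mem_multiIndices] at hβ
    exact hD β (by have := Finset.mem_Icc.1 hj; omega) t ht u

theorem memSobolev_group {s t : ℝ} {u : L2 N 2}
    (hu : TemperedDistribution.MemSobolev s 2 (u : 𝓢'(Rn N, Cd 2))) :
    TemperedDistribution.MemSobolev s 2 (group t u : 𝓢'(Rn N, Cd 2)) := by
  obtain ⟨f, hf⟩ := hu
  have h : ∀ i : Fin 2, TemperedDistribution.MemSobolev s 2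
      (𝓐 (propagator (axisSign i * t)) ((axisProj i).compLp u : 𝓢'(Rn N, Cd 2))) := fun i => by
    refine TemperedDistribution.MemSobolev.fourierMultiplierCLM_of_bounded
      ⟨(axisProj i).compLp f, ?_⟩ (hasTemperateGrowth_propagator _)
      ⟨1, fun ξ => (norm_propagator _ ξ).le⟩
    rw [← mapValues_coe, ← mapValues_coe, ← hf]
    rfl
  rw [group_coe, Fin.sum_univ_two]
  exact (h 0).add (h 1)

theorem group_mem_space (hk : (N : ℝ) / 2 < k) (t : ℝ) {u : L2 N 2} (hu : u ∈ space N 2 k m n) :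
    group t u ∈ space N 2 k m n := by
  refine ⟨memSobolev_group hu.1, fun β hβ => ?_, fun β hβ hβ' => ?_⟩
  · obtain ⟨C, hC⟩ := exists_weightedNorm_top_group_le (n := n) (m := m) hk |t| β
      (hβ.trans (Nat.sub_le _ _))
    exact (hC t le_rfl u).trans_lt (ENNReal.mul_lt_top ENNReal.coe_lt_top (spaceNorm_lt_top hu))
  · obtain ⟨C, hC⟩ := exists_weightedNorm_two_group_le (n := n) |t| β hβ hβ'
    exact (hC t le_rfl u).trans_lt (ENNReal.mul_lt_top ENNReal.coe_lt_top (spaceNorm_lt_top hu))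

theorem continuousInSpace_group (hk : (N : ℝ) / 2 < k) {u : L2 N 2}
    (hu : u ∈ space N 2 k m n) : ContinuousInSpace k m n (fun t => group t u) := by
  refine ⟨fun t => group_mem_space hk t hu, fun s => ?_⟩
  have htop : ∀ β : Fin N → ℕ, ∑ i, β i ≤ 2 * m - 2 →
      Tendsto (fun t => weightedNorm n ∞ β (group t u - group s u)) (𝓝 s) (𝓝 0) := by
    intro β hβ
    obtain ⟨C, hC⟩ := exists_weightedNorm_top_group_sub_le (n := n) (m := m) hk (|s| + 1) β
      (hβ.trans (Nat.sub_le _ _))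
    have hlim : Tendsto (fun t => C * ENNReal.ofReal |t - s| * spaceNorm k m n u) (𝓝 s)
        (𝓝 0) := by
      have h1 : Tendsto (fun t : ℝ => ENNReal.ofReal |t - s|) (𝓝 s) (𝓝 0) := by
        have : Tendsto (fun t : ℝ => |t - s|) (𝓝 s) (𝓝 |s - s|) :=
          (continuous_abs.comp (continuous_id.sub continuous_const)).tendsto s
        simpa using ENNReal.tendsto_ofReal this
      have h2 := ENNReal.Tendsto.const_mul (a := (C : ℝ≥0∞)) h1 (Or.inr ENNReal.coe_ne_top)
      have h3 := ENNReal.Tendsto.mul_const (b := spaceNorm k m n u) h2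
        (Or.inr (spaceNorm_lt_top hu).ne)
      simpa using h3
    refine tendsto_of_tendsto_of_tendsto_of_le_of_le' tendsto_const_nhds hlim
      (Eventually.of_forall fun _ => zero_le) ?_
    filter_upwards [Metric.ball_mem_nhds s one_pos] with t ht
    refine hC t s ?_ (by linarith) u
    rw [Metric.mem_ball, Real.dist_eq] at ht
    linarith [abs_sub_abs_le_abs_sub t s]
  have htwo : ∀ β : Fin N → ℕ, 2 * m - 1 ≤ ∑ i, β i → ∑ i, β i ≤ order k m →
      Tendsto (fun t => weightedNorm n 2 β (group t u - group s u)) (𝓝 s) (𝓝 0) :=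
    fun β hβ hβ' => tendsto_weightedNorm_two_group_sub β u (hu.2.2 β hβ hβ').ne s
  have h1 : Tendsto (fun t => ∑ j ∈ Finset.Icc 0 (2 * m - 2), ∑ β ∈ multiIndices N j,
      weightedNorm n ∞ β (group t u - group s u)) (𝓝 s)
      (𝓝 (∑ j ∈ Finset.Icc 0 (2 * m - 2), ∑ β ∈ multiIndices N j, 0)) :=
    tendsto_finsetSum _ fun j hj => tendsto_finsetSum _ fun β hβ => htop β (by
      rw [mem_multiIndices] at hβ
      exact hβ ▸ (Finset.mem_Icc.1 hj).2)
  have h2 : Tendsto (fun t => ∑ j ∈ Finset.Icc (2 * m - 1) (order k m), ∑ β ∈ multiIndices N j,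
      weightedNorm n 2 β (group t u - group s u)) (𝓝 s)
      (𝓝 (∑ j ∈ Finset.Icc (2 * m - 1) (order k m), ∑ β ∈ multiIndices N j, 0)) :=
    tendsto_finsetSum _ fun j hj => tendsto_finsetSum _ fun β hβ => by
      rw [mem_multiIndices] at hβ
      exact htwo β (hβ ▸ (Finset.mem_Icc.1 hj).1) (hβ ▸ (Finset.mem_Icc.1 hj).2)
  have h := h1.add h2
  simp only [Finset.sum_const_zero, add_zero] at h
  exact h

theorem exists_iSup_weightedNorm_group_sub_le (hk : (N : ℝ) / 2 < k) (T : ℝ) :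
    ∃ C : ℝ≥0, ∀ t : ℝ, |t| ≤ T → ∀ u : L2 N 2,
      ⨆ (β : Fin N → ℕ) (_ : ∑ i, β i ≤ 2 * m), weightedNorm n ∞ β (group t u - u)
        ≤ C * ENNReal.ofReal |t| * spaceNorm k m n u := by
  have h1 : ∀ β : Fin N → ℕ, ∃ C : ℝ≥0, ∑ i, β i ≤ 2 * m → ∀ t : ℝ, |t| ≤ T → ∀ u : L2 N 2,
      weightedNorm n ∞ β (group t u - u) ≤ C * ENNReal.ofReal |t| * spaceNorm k m n u := by
    intro β
    by_cases hβ : ∑ i, β i ≤ 2 * m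
    · obtain ⟨C, hC⟩ := exists_weightedNorm_top_group_sub_le (n := n) (m := m) hk T β hβ
      refine ⟨C, fun _ t ht u => ?_⟩
      have h := hC t 0 ht (by simpa using (abs_nonneg t).trans ht) u
      rwa [group_zero, sub_zero] at h
    · exact ⟨0, fun h => absurd h hβ⟩
  choose C hC using h1
  refine ⟨∑ β ∈ (Finset.range (2 * m + 1)).biUnion (multiIndices N), C β,
    fun t ht u => iSup₂_le fun β hβ => (hC β hβ t ht u).trans ?_⟩
  gcongr
  refine Finset.single_le_sum (f := C) (fun _ _ => zero_le) ?_
  rw [Finset.mem_biUnion]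
  exact ⟨∑ i, β i, by simpa [Nat.lt_succ_iff] using hβ, mem_multiIndices.2 rfl⟩

end Group

end HalfWave

end

theorem mainTheorem4 (N k m n : ℕ) (hN : 1 ≤ N)
    (hk : (N : ℝ) / 2 < k)
    (hn : max ((N : ℝ) / 2 + 1) ((N : ℝ) / 2) < n)
    (hm : k + n + 3 ≤ 2 * m) :
    (∀ ψ ∈ HalfWave.space N 2 k m n,
      HalfWave.ContinuousInSpace k m n (fun t => HalfWave.group t ψ)) ∧
    (∀ T : ℝ, ∃ C : ℝ, 0 < C ∧ ∀ t : ℝ, |t| ≤ T → ∀ ψ ∈ HalfWave.space N 2 k m n,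
      HalfWave.spaceNorm k m n (HalfWave.group t ψ)
        ≤ ENNReal.ofReal C * HalfWave.spaceNorm k m n ψ) ∧
    (∃ C t₀ : ℝ, 0 < C ∧ 0 < t₀ ∧ ∀ t : ℝ, |t| ≤ t₀ → ∀ ψ ∈ HalfWave.space N 2 k m n,
      HalfWave.spaceNorm k m n (HalfWave.group t ψ)
          ≤ ENNReal.ofReal (C * (1 + |t|) ^ (2 * m + n + 1)) * HalfWave.spaceNorm k m n ψ ∧
      ⨆ (β : Fin N → ℕ) (_ : ∑ i, β i ≤ 2 * m),
          HalfWave.weightedNorm n ∞ β (HalfWave.group t ψ - ψ)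
        ≤ ENNReal.ofReal (C * |t| * (1 + |t|) ^ (2 * m + n + 1))
          * HalfWave.spaceNorm k m n ψ) := by
  refine ⟨fun ψ hψ => HalfWave.continuousInSpace_group hk hψ, fun T => ?_, ?_⟩
  · obtain ⟨C, hC⟩ := HalfWave.exists_spaceNorm_group_le (n := n) (m := m) hk T
    refine ⟨C + 1, by positivity, fun t ht ψ _ => (hC t ht ψ).trans ?_⟩
    gcongr
    rw [← ENNReal.ofReal_coe_nnreal]
    exact ENNReal.ofReal_le_ofReal (by linarith)
  · obtain ⟨C, hC⟩ := HalfWave.exists_spaceNorm_group_le (n := n) (m := m) hk 1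
    obtain ⟨D, hD⟩ := HalfWave.exists_iSup_weightedNorm_group_sub_le (n := n) (m := m) hk 1
    have hC0 : (0 : ℝ) ≤ C := C.coe_nonneg
    have hD0 : (0 : ℝ) ≤ D := D.coe_nonneg
    refine ⟨C + D + 1, 1, by positivity, one_pos, fun t ht ψ _ => ⟨?_, ?_⟩⟩
    all_goals
      have hpow : 1 ≤ (1 + |t|) ^ (2 * m + n + 1) :=
        one_le_pow₀ (by linarith [abs_nonneg t])
    · refine (hC t ht ψ).trans ?_
      gcongr
      rw [← ENNReal.ofReal_coe_nnreal]
      exact ENNReal.ofReal_le_ofReal (by nlinarith)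
    · refine (hD t ht ψ).trans ?_
      gcongr
      rw [← ENNReal.ofReal_coe_nnreal, ← ENNReal.ofReal_mul hD0]
      refine ENNReal.ofReal_le_ofReal ?_
      calc (D : ℝ) * |t| ≤ (C + D + 1) * |t| * 1 := by nlinarith [abs_nonneg t]
        _ ≤ (C + D + 1) * |t| * (1 + |t|) ^ (2 * m + n + 1) := by gcongr
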